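/- **Theorem 3.9.** Let $q\in(0,1)$. Let $U_q\mathfrak{sl}_2$ be the $\mathbb C$-algebra generated by $K,K^{-1},E,F$ with the relations $$KK^{-1}=K^{-1}K=1,\quad K^{\pm1}E=q^{\pm2}EK^{\pm1},\quad K^{\pm1}F=q^{\mp2}FK^{\pm1},\quad EF-FE=\frac{K-K^{-1}}{q-q^{-1}},$$ with the comultiplication $\Delta(K^{\pm1})=K^{\pm1}\otimes K^{\pm1}$, $\Delta(E)=E\otimes1+K\otimes E$, $\Delta(F)=F\otimes K^{-1}+1\otimes F$ and the counit $\varepsilon(K^{\pm1})=1$, $\varepsilon(E)=\varepsilon(F)=0$. Let $\mathrm{Pol}(\mathbb C)_q$ be the unital $\mathbb C$-algebra with generators $z,z^*$ and the relation $z^*z=q^2zz^*+1-q^2$, equipped with the $U_q\mathfrak{sl}_2$-module algebra structure (that is, $\xi\cdot1=\varepsilon(\xi)1$ and the multiplication is a morphism of $U_q\mathfrak{sl}_2$-modules) such that $$K^{\pm1}z=q^{\pm2}z,\quad Fz=q^{1/2},\quad Ez=-q^{1/2}z^2,\qquad K^{\pm1}z^*=q^{\mp2}z^*,\quad Ez^*=q^{-3/2},\quad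 Fz^*=-q^{5/2}z^{*2}.$$ Let $D(U)_q'$ be the $\mathrm{Pol}(\mathbb C)_q$-bimodule of formal series $f=\sum_{j,k\ge0}a_{jk}z^jz^{*k}$, $a_{jk}\in\mathbb C$, with the topology of coefficientwise convergence, in which $\mathrm{Pol}(\mathbb C)_q$ is the dense subspace of finite sums, and extend the $U_q\mathfrak{sl}_2$-action to $D(U)_q'$ by continuity. Let $$D(U)_q=\{f\in D(U)_q' \mid z^{*N}f=fz^N=0 \text{ for some } N\in\mathbb N\},$$ which is a $U_q\mathfrak{sl}_2$-submodule of $D(U)_q'$. Let $T$ be the representation of $\mathrm{Pol}(\mathbb C)_q$ in the space with basis $e_0,e_1,e_2,\dots$ given by $$T(z)e_m=(1-q^{2(m+1)})^{1/2}e_{m+1},\qquad T(z^*)e_m=(1-q^{2m})^{1/2}e_{m-1},\qquad T(z^*)e_0=0,$$ and for $f=\sum a_{jk}z^jz^{*k}\in D(U)_q'$ let $l_{mn}(f)=\sum_{j,k}a_{jk}\,l_{mn}(z^jz^{*k})$, where $l_{mn}(z^jz^{*k})$ is the coefficient of $e_m$ in $T(z^jz^{*k})e_n$ (it vanishes unless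 $j\le m$ and $k\le n$, so the sum is finite). Then there is exactly one $f_0\in D(U)_q$ with $l_{00}(f_0)=1$ and $l_{mn}(f_0)=0$ for $(m,n)\ne(0,0)$, and $f_0$ generates the $U_q\mathfrak{sl}_2$-module $D(U)_q$: $\;U_q\mathfrak{sl}_2\cdot f_0=D(U)_q$. -/

import Mathlib

namespace QDisc

noncomputable section

/-! The deformation parameter is a real number `q` in the interval `(0, 1)`. -/

/-- The parameter `q` as a complex number. -/
def qc (q : Set.Ioo (0 : ℝ) 1) : ℂ := ((q : ℝ) : ℂ)

/-- The positive square root `q ^ (1/2)` as a complex number. -/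
def qh (q : Set.Ioo (0 : ℝ) 1) : ℂ := ((Real.sqrt (q : ℝ) : ℝ) : ℂ)

theorem qc_ne (q : Set.Ioo (0 : ℝ) 1) : qc q ≠ 0 := by
  have := q.2.1
  simp [qc, this.ne']

theorem qh_sq (q : Set.Ioo (0 : ℝ) 1) : qh q ^ 2 = qc q := by
  have := q.2.1.le
  simp only [qh, qc, ← Complex.ofReal_pow, Real.sq_sqrt this]

theorem one_sub_ne (q : Set.Ioo (0 : ℝ) 1) : 1 - qc q ^ 2 ≠ 0 := by
  have h0 := q.2.1
  have h1 := q.2.2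
  have : (1 : ℝ) - (q : ℝ) ^ 2 ≠ 0 := by nlinarith
  simp only [qc]
  exact_mod_cast this

/-! ### The quantum universal enveloping algebra of `sl₂` -/

/-- The four generators of `U_q sl₂`. -/
inductive UGen
  | K | Kinv | E | F

/-- The defining relations of `U_q sl₂`. -/
inductive URel (q : Set.Ioo (0 : ℝ) 1) : FreeAlgebra ℂ UGen → FreeAlgebra ℂ UGen → Prop
  | KKinv : URel q (FreeAlgebra.ι ℂ .K * FreeAlgebra.ι ℂ .Kinv) 1
  | KinvK : URel q (FreeAlgebra.ι ℂ .Kinv * FreeAlgebra.ι ℂ .K) 1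
  | KE : URel q (FreeAlgebra.ι ℂ .K * FreeAlgebra.ι ℂ .E)
      (qc q ^ 2 • (FreeAlgebra.ι ℂ .E * FreeAlgebra.ι ℂ .K))
  | KinvE : URel q (FreeAlgebra.ι ℂ .Kinv * FreeAlgebra.ι ℂ .E)
      ((qc q ^ 2)⁻¹ • (FreeAlgebra.ι ℂ .E * FreeAlgebra.ι ℂ .Kinv))
  | KF : URel q (FreeAlgebra.ι ℂ .K * FreeAlgebra.ι ℂ .F)
      ((qc q ^ 2)⁻¹ • (FreeAlgebra.ι ℂ .F * FreeAlgebra.ι ℂ .K))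
  | KinvF : URel q (FreeAlgebra.ι ℂ .Kinv * FreeAlgebra.ι ℂ .F)
      (qc q ^ 2 • (FreeAlgebra.ι ℂ .F * FreeAlgebra.ι ℂ .Kinv))
  | EF : URel q
      (FreeAlgebra.ι ℂ .E * FreeAlgebra.ι ℂ .F - FreeAlgebra.ι ℂ .F * FreeAlgebra.ι ℂ .E)
      ((qc q - (qc q)⁻¹)⁻¹ • (FreeAlgebra.ι ℂ .K - FreeAlgebra.ι ℂ .Kinv))

/-- The algebra `U_q sl₂` over `ℂ`. -/
def Uq (q : Set.Ioo (0 : ℝ) 1) : Type := RingQuot (URel q)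

instance (q : Set.Ioo (0 : ℝ) 1) : Ring (Uq q) := inferInstanceAs (Ring (RingQuot (URel q)))

instance (q : Set.Ioo (0 : ℝ) 1) : Algebra ℂ (Uq q) :=
  inferInstanceAs (Algebra ℂ (RingQuot (URel q)))

/-- The quotient map from the free algebra onto `U_q sl₂`. -/
def uMk (q : Set.Ioo (0 : ℝ) 1) : FreeAlgebra ℂ UGen →ₐ[ℂ] Uq q := RingQuot.mkAlgHom ℂ (URel q)

/-- The class of a generator in `U_q sl₂`. -/
def ugen (q : Set.Ioo (0 : ℝ) 1) (g : UGen) : Uq q :=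
  uMk q (FreeAlgebra.ι ℂ g)

/-- An algebra map out of `U_q sl₂` given by the images of the generators. -/
def uLift (q : Set.Ioo (0 : ℝ) 1) {A : Type} [Ring A] [Algebra ℂ A] (φ : UGen → A)
    (h : ∀ ⦃x y⦄, URel q x y → FreeAlgebra.lift ℂ φ x = FreeAlgebra.lift ℂ φ y) : Uq q →ₐ[ℂ] A :=
  RingQuot.liftAlgHom ℂ ⟨FreeAlgebra.lift ℂ φ, h⟩

theorem uLift_ugen (q : Set.Ioo (0 : ℝ) 1) {A : Type} [Ring A] [Algebra ℂ A] (φ : UGen → A)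
    (h : ∀ ⦃x y⦄, URel q x y → FreeAlgebra.lift ℂ φ x = FreeAlgebra.lift ℂ φ y) (g : UGen) :
    uLift q φ h (ugen q g) = φ g :=
  (RingQuot.liftAlgHom_mkAlgHom_apply ℂ (FreeAlgebra.lift ℂ φ) h _).trans
    (FreeAlgebra.lift_ι_apply _ _)

theorem u_induction {q : Set.Ioo (0 : ℝ) 1} {P : Uq q → Prop}
    (hc : ∀ c : ℂ, P (algebraMap ℂ (Uq q) c)) (hadd : ∀ a b, P a → P b → P (a + b))
    (hmul : ∀ a b, P a → P b → P (a * b)) (hg : ∀ g, P (ugen q g)) (a : Uq q) : P a := by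
  obtain ⟨x, rfl⟩ : ∃ x, uMk q x = a := RingQuot.mkAlgHom_surjective ℂ (URel q) a
  induction x using FreeAlgebra.induction with
  | grade0 r => rw [AlgHom.commutes]; exact hc r
  | grade1 i => exact hg i
  | mul a b ha hb => rw [map_mul]; exact hmul _ _ ha hb
  | add a b ha hb => rw [map_add]; exact hadd _ _ ha hb

/-! ### The polynomial algebra `Pol(ℂ)_q` -/

/-- The generators `z` and `z*` of `Pol(ℂ)_q`. -/
inductive PolGen
  | z | zs

/-- The defining relation `z* z = q² z z* + 1 - q²`. -/
inductive PolRel (q : Set.Ioo (0 : ℝ) 1) : FreeAlgebra ℂ PolGen → FreeAlgebra ℂ PolGen → Prop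
  | comm : PolRel q (FreeAlgebra.ι ℂ .zs * FreeAlgebra.ι ℂ .z)
      (qc q ^ 2 • (FreeAlgebra.ι ℂ .z * FreeAlgebra.ι ℂ .zs) + (1 - qc q ^ 2) • 1)

/-- The algebra `Pol(ℂ)_q`. -/
def Pol (q : Set.Ioo (0 : ℝ) 1) : Type := RingQuot (PolRel q)

instance (q : Set.Ioo (0 : ℝ) 1) : Ring (Pol q) := inferInstanceAs (Ring (RingQuot (PolRel q)))

instance (q : Set.Ioo (0 : ℝ) 1) : Algebra ℂ (Pol q) :=
  inferInstanceAs (Algebra ℂ (RingQuot (PolRel q)))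

/-- The quotient map from the free algebra onto `Pol(ℂ)_q`. -/
def polMk (q : Set.Ioo (0 : ℝ) 1) : FreeAlgebra ℂ PolGen →ₐ[ℂ] Pol q :=
  RingQuot.mkAlgHom ℂ (PolRel q)

/-- The generator `z`. -/
def z (q : Set.Ioo (0 : ℝ) 1) : Pol q := polMk q (FreeAlgebra.ι ℂ .z)

/-- The generator `z*`. -/
def zs (q : Set.Ioo (0 : ℝ) 1) : Pol q := polMk q (FreeAlgebra.ι ℂ .zs)

theorem zs_mul_z (q : Set.Ioo (0 : ℝ) 1) :
    zs q * z q = qc q ^ 2 • (z q * zs q) + (1 - qc q ^ 2) • 1 := by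
  have h : polMk q _ = polMk q _ := RingQuot.mkAlgHom_rel ℂ (PolRel.comm (q := q))
  simp only [map_mul, map_add, map_smul, map_one] at h
  exact h

/-- An algebra map out of `Pol(ℂ)_q` given by the images of the two generators. -/
def polLift (q : Set.Ioo (0 : ℝ) 1) {A : Type} [Ring A] [Algebra ℂ A] (a b : A)
    (h : b * a = qc q ^ 2 • (a * b) + (1 - qc q ^ 2) • 1) : Pol q →ₐ[ℂ] A :=
  RingQuot.liftAlgHom ℂ ⟨FreeAlgebra.lift ℂ (fun g => PolGen.rec a b g), by
    rintro _ _ ⟨⟩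
    simpa only [map_mul, map_add, map_smul, map_one, FreeAlgebra.lift_ι_apply] using h⟩

theorem polLift_z (q : Set.Ioo (0 : ℝ) 1) {A : Type} [Ring A] [Algebra ℂ A] (a b : A)
    (h : b * a = qc q ^ 2 • (a * b) + (1 - qc q ^ 2) • 1) : polLift q a b h (z q) = a :=
  (RingQuot.liftAlgHom_mkAlgHom_apply ℂ _ _ _).trans (FreeAlgebra.lift_ι_apply _ _)

theorem polLift_zs (q : Set.Ioo (0 : ℝ) 1) {A : Type} [Ring A] [Algebra ℂ A] (a b : A)
    (h : b * a = qc q ^ 2 • (a * b) + (1 - qc q ^ 2) • 1) : polLift q a b h (zs q) = b :=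
  (RingQuot.liftAlgHom_mkAlgHom_apply ℂ _ _ _).trans (FreeAlgebra.lift_ι_apply _ _)

theorem pol_induction {q : Set.Ioo (0 : ℝ) 1} {P : Pol q → Prop}
    (h1 : P 1) (hadd : ∀ f g, P f → P g → P (f + g)) (hsmul : ∀ (c : ℂ) f, P f → P (c • f))
    (hz : ∀ f, P f → P (z q * f)) (hzs : ∀ f, P f → P (zs q * f)) (f : Pol q) : P f := by
  obtain ⟨x, rfl⟩ : ∃ x, polMk q x = f := RingQuot.mkAlgHom_surjective ℂ (PolRel q) f
  have key : ∀ g, P g → P (polMk q x * g) := by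
    induction x using FreeAlgebra.induction with
    | grade0 r =>
      intro g hg
      rw [AlgHom.commutes, ← Algebra.smul_def]
      exact hsmul r g hg
    | grade1 i =>
      intro g hg
      cases i
      · exact hz g hg
      · exact hzs g hg
    | mul a b ha hb =>
      intro g hg
      rw [map_mul, mul_assoc]
      exact ha _ (hb _ hg)
    | add a b ha hb =>
      intro g hg
      rw [map_add, add_mul]
      exact hadd _ _ (ha _ hg) (hb _ hg)
  simpa using key 1 h1

/-! ### The covariant action of `U_q sl₂` on `Pol(ℂ)_q`

The comultiplication is `Δ(K^{±1}) = K^{±1} ⊗ K^{±1}`, `Δ(E) = E ⊗ 1 + K ⊗ E` and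
`Δ(F) = F ⊗ K⁻¹ + 1 ⊗ F`.  Hence, in a covariant algebra, `K^{±1}` act by algebra endomorphisms and
`E (f g) = E f * g + K f * E g`, `F (f g) = F f * K⁻¹ g + f * F g`.  The last two rules say that
`f ↦ !![K f, E f; 0, f]` and `f ↦ !![f, F f; 0, K⁻¹ f]` are algebra maps, and this is how `E`
and `F` are constructed from their values on the generators:
`K z = q² z`, `K z* = q⁻² z*`, `E z = - q^(1/2) z²`, `E z* = q^(-3/2)`,
`F z = q^(1/2)`, `F z* = - q^(5/2) z*²`. -/

/-- The action of `K`. -/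
def polK (q : Set.Ioo (0 : ℝ) 1) : Pol q →ₐ[ℂ] Pol q :=
  polLift q (qc q ^ 2 • z q) ((qc q ^ 2)⁻¹ • zs q) (by
    have := qc_ne q
    rw [smul_mul_smul_comm, smul_mul_smul_comm, zs_mul_z]
    field_simp
    simp)

/-- The action of `K⁻¹`. -/
def polKinv (q : Set.Ioo (0 : ℝ) 1) : Pol q →ₐ[ℂ] Pol q :=
  polLift q ((qc q ^ 2)⁻¹ • z q) (qc q ^ 2 • zs q) (by
    have := qc_ne q
    rw [smul_mul_smul_comm, smul_mul_smul_comm, zs_mul_z]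
    field_simp
    simp)

@[simp] theorem polK_z (q : Set.Ioo (0 : ℝ) 1) : polK q (z q) = qc q ^ 2 • z q := polLift_z ..
@[simp] theorem polK_zs (q : Set.Ioo (0 : ℝ) 1) : polK q (zs q) = (qc q ^ 2)⁻¹ • zs q :=
  polLift_zs ..
@[simp] theorem polKinv_z (q : Set.Ioo (0 : ℝ) 1) : polKinv q (z q) = (qc q ^ 2)⁻¹ • z q :=
  polLift_z ..
@[simp] theorem polKinv_zs (q : Set.Ioo (0 : ℝ) 1) : polKinv q (zs q) = qc q ^ 2 • zs q :=
  polLift_zs ..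

theorem zs_mul_z_sq (q : Set.Ioo (0 : ℝ) 1) :
    zs q * (z q * z q) = qc q ^ 4 • (z q * (z q * zs q)) + (1 - qc q ^ 4) • z q := by
  rw [← mul_assoc, zs_mul_z, add_mul, smul_mul_assoc, mul_assoc, zs_mul_z]
  simp only [mul_add, smul_add, mul_smul_comm, smul_mul_assoc, mul_one, one_mul]
  module

theorem zs_sq_mul_z (q : Set.Ioo (0 : ℝ) 1) :
    zs q * (zs q * z q) = qc q ^ 4 • (z q * (zs q * zs q)) + (1 - qc q ^ 4) • zs q := by
  rw [zs_mul_z, mul_add, mul_smul_comm, ← mul_assoc, zs_mul_z]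
  simp only [add_mul, smul_add, mul_smul_comm, smul_mul_assoc, mul_one, one_mul, mul_assoc]
  module

/-- The algebra map `f ↦ !![K f, E f; 0, f]`. -/
def polEMat (q : Set.Ioo (0 : ℝ) 1) : Pol q →ₐ[ℂ] Matrix (Fin 2) (Fin 2) (Pol q) :=
  polLift q
    !![qc q ^ 2 • z q, -(qh q • (z q * z q)); 0, z q]
    !![(qc q ^ 2)⁻¹ • zs q, (qh q / qc q ^ 2) • 1; 0, zs q] (by
    have := qc_ne q
    ext i j
    fin_cases i <;> fin_cases j
    · simp [Matrix.mul_apply, Fin.sum_univ_two, zs_mul_z, smul_smul, this]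
    · simp [Matrix.mul_apply, Fin.sum_univ_two, zs_mul_z_sq, mul_assoc]
      match_scalars <;> (field_simp; try ring)
    · simp [Matrix.mul_apply, Fin.sum_univ_two]
    · simp [Matrix.mul_apply, Fin.sum_univ_two, zs_mul_z])

/-- The algebra map `f ↦ !![f, F f; 0, K⁻¹ f]`. -/
def polFMat (q : Set.Ioo (0 : ℝ) 1) : Pol q →ₐ[ℂ] Matrix (Fin 2) (Fin 2) (Pol q) :=
  polLift q
    !![z q, qh q • 1; 0, (qc q ^ 2)⁻¹ • z q]
    !![zs q, -((qh q * qc q ^ 2) • (zs q * zs q)); 0, qc q ^ 2 • zs q] (by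
    have := qc_ne q
    ext i j
    fin_cases i <;> fin_cases j
    · simp [Matrix.mul_apply, Fin.sum_univ_two, zs_mul_z]
    · simp [Matrix.mul_apply, Fin.sum_univ_two, zs_sq_mul_z, mul_assoc]
      match_scalars <;> (field_simp; try ring)
    · simp [Matrix.mul_apply, Fin.sum_univ_two]
    · simp [Matrix.mul_apply, Fin.sum_univ_two, zs_mul_z, smul_smul, this])

/-- The action of `E`. -/
def polE (q : Set.Ioo (0 : ℝ) 1) : Pol q →ₗ[ℂ] Pol q :=
  Matrix.entryLinearMap ℂ (Pol q) 0 1 ∘ₗ (polEMat q).toLinearMap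

/-- The action of `F`. -/
def polF (q : Set.Ioo (0 : ℝ) 1) : Pol q →ₗ[ℂ] Pol q :=
  Matrix.entryLinearMap ℂ (Pol q) 0 1 ∘ₗ (polFMat q).toLinearMap

@[simp] theorem polE_one (q : Set.Ioo (0 : ℝ) 1) : polE q 1 = 0 := by
  simp [polE]

@[simp] theorem polF_one (q : Set.Ioo (0 : ℝ) 1) : polF q 1 = 0 := by
  simp [polF]

@[simp] theorem polE_z (q : Set.Ioo (0 : ℝ) 1) : polE q (z q) = -(qh q • (z q * z q)) := by
  simp [polE, polEMat, polLift_z]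

/- Here `q^(1/2) / q² = q^(-3/2)`. -/
@[simp] theorem polE_zs (q : Set.Ioo (0 : ℝ) 1) : polE q (zs q) = (qh q / qc q ^ 2) • 1 := by
  simp [polE, polEMat, polLift_zs]

@[simp] theorem polF_z (q : Set.Ioo (0 : ℝ) 1) : polF q (z q) = qh q • 1 := by
  simp [polF, polFMat, polLift_z]

/- Here `q^(1/2) q² = q^(5/2)`. -/
@[simp] theorem polF_zs (q : Set.Ioo (0 : ℝ) 1) :
    polF q (zs q) = -((qh q * qc q ^ 2) • (zs q * zs q)) := by
  simp [polF, polFMat, polLift_zs]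

theorem polEMat_z (q : Set.Ioo (0 : ℝ) 1) :
    polEMat q (z q) = !![qc q ^ 2 • z q, -(qh q • (z q * z q)); 0, z q] := polLift_z ..

theorem polEMat_zs (q : Set.Ioo (0 : ℝ) 1) :
    polEMat q (zs q) = !![(qc q ^ 2)⁻¹ • zs q, (qh q / qc q ^ 2) • 1; 0, zs q] := polLift_zs ..

theorem polEMat_eq (q : Set.Ioo (0 : ℝ) 1) (f : Pol q) :
    polEMat q f = !![polK q f, polE q f; 0, f] := by
  have h : polEMat q f 0 0 = polK q f ∧ polEMat q f 1 0 = 0 ∧ polEMat q f 1 1 = f := by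
    induction f using pol_induction with
    | h1 => simp
    | hadd f g hf hg => simp [hf, hg]
    | hsmul c f hf => simp [hf]
    | hz f hf => simp [Matrix.mul_apply, hf, polEMat_z]
    | hzs f hf => simp [Matrix.mul_apply, hf, polEMat_zs]
  ext i j
  fin_cases i <;> fin_cases j <;> simp [h, polE]

theorem polFMat_z (q : Set.Ioo (0 : ℝ) 1) :
    polFMat q (z q) = !![z q, qh q • 1; 0, (qc q ^ 2)⁻¹ • z q] := polLift_z ..

theorem polFMat_zs (q : Set.Ioo (0 : ℝ) 1) :
    polFMat q (zs q) = !![zs q, -((qh q * qc q ^ 2) • (zs q * zs q)); 0, qc q ^ 2 • zs q] := polLift_zs ..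

theorem polFMat_eq (q : Set.Ioo (0 : ℝ) 1) (f : Pol q) :
    polFMat q f = !![f, polF q f; 0, polKinv q f] := by
  have h : polFMat q f 0 0 = f ∧ polFMat q f 1 0 = 0 ∧ polFMat q f 1 1 = polKinv q f := by
    induction f using pol_induction with
    | h1 => simp
    | hadd f g hf hg => simp [hf, hg]
    | hsmul c f hf => simp [hf]
    | hz f hf => simp [Matrix.mul_apply, hf, polFMat_z]
    | hzs f hf => simp [Matrix.mul_apply, hf, polFMat_zs]
  ext i j
  fin_cases i <;> fin_cases j <;> simp [h, polF]

/-- Covariance for `Δ(E) = E ⊗ 1 + K ⊗ E`. -/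
theorem polE_mul (q : Set.Ioo (0 : ℝ) 1) (f g : Pol q) :
    polE q (f * g) = polE q f * g + polK q f * polE q g := by
  have h : polEMat q (f * g) 0 1 = (polEMat q f * polEMat q g) 0 1 := by rw [map_mul]
  rw [polEMat_eq, polEMat_eq, polEMat_eq] at h
  simpa [Matrix.mul_apply, Fin.sum_univ_two, add_comm] using h

/-- Covariance for `Δ(F) = F ⊗ K⁻¹ + 1 ⊗ F`. -/
theorem polF_mul (q : Set.Ioo (0 : ℝ) 1) (f g : Pol q) :
    polF q (f * g) = polF q f * polKinv q g + f * polF q g := by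
  have h : polFMat q (f * g) 0 1 = (polFMat q f * polFMat q g) 0 1 := by rw [map_mul]
  rw [polFMat_eq, polFMat_eq, polFMat_eq] at h
  simpa [Matrix.mul_apply, Fin.sum_univ_two, add_comm] using h


/-! These operators satisfy the relations of `U_q sl₂`. -/

theorem polKinv_polK (q : Set.Ioo (0 : ℝ) 1) (f : Pol q) : polKinv q (polK q f) = f := by
  have := qc_ne q
  induction f using pol_induction with
  | h1 => simp
  | hadd f g hf hg => simp [hf, hg]
  | hsmul c f hf => simp [hf]
  | hz f hf => simp [hf, smul_smul, this]
  | hzs f hf => simp [hf, smul_smul, this]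

theorem polK_polKinv (q : Set.Ioo (0 : ℝ) 1) (f : Pol q) : polK q (polKinv q f) = f := by
  have := qc_ne q
  induction f using pol_induction with
  | h1 => simp
  | hadd f g hf hg => simp [hf, hg]
  | hsmul c f hf => simp [hf]
  | hz f hf => simp [hf, smul_smul, this]
  | hzs f hf => simp [hf, smul_smul, this]

theorem polK_polE (q : Set.Ioo (0 : ℝ) 1) (f : Pol q) :
    polK q (polE q f) = qc q ^ 2 • polE q (polK q f) := by
  have := qc_ne q
  induction f using pol_induction with
  | h1 => simp
  | hadd f g hf hg => simp [hf, hg]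
  | hsmul c f hf => simp only [map_smul, hf]; rw [smul_comm]
  | hz f hf =>
    simp [polE_mul, hf, mul_assoc]
    match_scalars <;> field_simp
  | hzs f hf =>
    simp [polE_mul, hf, mul_assoc]
    match_scalars <;> field_simp

theorem polK_polF (q : Set.Ioo (0 : ℝ) 1) (f : Pol q) :
    polK q (polF q f) = (qc q ^ 2)⁻¹ • polF q (polK q f) := by
  have := qc_ne q
  induction f using pol_induction with
  | h1 => simp
  | hadd f g hf hg => simp [hf, hg]
  | hsmul c f hf => simp only [map_smul, hf]; rw [smul_comm]
  | hz f hf =>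
    simp [polF_mul, hf, mul_assoc, polK_polKinv, polKinv_polK]
    match_scalars <;> field_simp
  | hzs f hf =>
    simp [polF_mul, hf, mul_assoc, polK_polKinv, polKinv_polK]
    match_scalars <;> field_simp

theorem polKinv_polE (q : Set.Ioo (0 : ℝ) 1) (f : Pol q) :
    polKinv q (polE q f) = (qc q ^ 2)⁻¹ • polE q (polKinv q f) := by
  have h := polK_polE q (polKinv q f)
  rw [polK_polKinv] at h
  rw [← polKinv_polK q (polE q (polKinv q f)), h, map_smul, smul_smul,
    inv_mul_cancel₀ (pow_ne_zero 2 (qc_ne q)), one_smul]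

theorem polKinv_polF (q : Set.Ioo (0 : ℝ) 1) (f : Pol q) :
    polKinv q (polF q f) = qc q ^ 2 • polF q (polKinv q f) := by
  have h := polK_polF q (polKinv q f)
  rw [polK_polKinv] at h
  rw [← polKinv_polK q (polF q (polKinv q f)), h, map_smul, smul_smul,
    mul_inv_cancel₀ (pow_ne_zero 2 (qc_ne q)), one_smul]

theorem polE_polF (q : Set.Ioo (0 : ℝ) 1) (f : Pol q) :
    polE q (polF q f) - polF q (polE q f) =
      (qc q - (qc q)⁻¹)⁻¹ • (polK q f - polKinv q f) := by
  have h0 := qc_ne q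
  have h1 := one_sub_ne q
  have h2 : qc q ^ 2 - 1 ≠ 0 := fun h => h1 (by linear_combination -h)
  have h3 : qc q - (qc q)⁻¹ ≠ 0 := by
    intro h
    apply h2
    field_simp at h
    simpa using h
  have hs := qh_sq q
  induction f using pol_induction with
  | h1 => simp
  | hadd f g hf hg =>
    simp only [map_add]
    rw [add_sub_add_comm, hf, hg]
    module
  | hsmul c f hf =>
    simp only [map_smul]
    rw [← smul_sub, hf]
    module
  | hz f hf =>
    rw [sub_eq_iff_eq_add] at hf
    simp [polE_mul, polF_mul, hf, mul_assoc, mul_add, mul_sub, polKinv_polE]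
    match_scalars <;> field_simp <;>
      first
        | ring1
        | linear_combination (qc q ^ 4 - 1) * hs
        | linear_combination (1 - qc q ^ 4) * hs
  | hzs f hf =>
    rw [sub_eq_iff_eq_add] at hf
    simp [polE_mul, polF_mul, hf, mul_assoc, mul_add, mul_sub, polKinv_polE]
    match_scalars <;> field_simp <;>
      first
        | ring1
        | linear_combination (qc q ^ 4 - 1) * hs
        | linear_combination (1 - qc q ^ 4) * hs

/-- The action of a generator of `U_q sl₂` on `Pol(ℂ)_q`. -/
def polGen (q : Set.Ioo (0 : ℝ) 1) : UGen → Module.End ℂ (Pol q)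
  | .K => (polK q).toLinearMap
  | .Kinv => (polKinv q).toLinearMap
  | .E => polE q
  | .F => polF q

/-- The covariant action of `U_q sl₂` on `Pol(ℂ)_q`. -/
def polAct (q : Set.Ioo (0 : ℝ) 1) : Uq q →ₐ[ℂ] Module.End ℂ (Pol q) :=
  uLift q (polGen q) (by
    rintro _ _ ⟨⟩ <;> ext f <;>
      simp only [map_mul, map_sub, map_smul, map_one, FreeAlgebra.lift_ι_apply, polGen,
        Module.End.mul_apply, Module.End.one_apply, LinearMap.sub_apply, LinearMap.smul_apply,
        AlgHom.toLinearMap_apply]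
    · exact polK_polKinv q f
    · exact polKinv_polK q f
    · exact polK_polE q f
    · exact polKinv_polE q f
    · exact polK_polF q f
    · exact polKinv_polF q f
    · exact polE_polF q f)

@[simp] theorem polAct_ugen (q : Set.Ioo (0 : ℝ) 1) (g : UGen) :
    polAct q (ugen q g) = polGen q g :=
  uLift_ugen ..

/-! ### Distributions: formal series `∑ a_{jk} z^j z*^k` -/

/-- The space `D(U)_q'` of formal series `∑ a_{jk} z^j z*^k`, given by the coefficients `a_{jk}`,
with the topology of coefficientwise convergence. -/
def Distr (_q : Set.Ioo (0 : ℝ) 1) : Type := ℕ × ℕ → ℂ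

section
variable (q : Set.Ioo (0 : ℝ) 1)

instance : AddCommGroup (Distr q) := inferInstanceAs (AddCommGroup (ℕ × ℕ → ℂ))
instance : Module ℂ (Distr q) := inferInstanceAs (Module ℂ (ℕ × ℕ → ℂ))
instance : TopologicalSpace (Distr q) := inferInstanceAs (TopologicalSpace (ℕ × ℕ → ℂ))
instance : IsTopologicalAddGroup (Distr q) :=
  inferInstanceAs (IsTopologicalAddGroup (ℕ × ℕ → ℂ))
instance : ContinuousConstSMul ℂ (Distr q) :=
  inferInstanceAs (ContinuousConstSMul ℂ (ℕ × ℕ → ℂ))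
instance : T2Space (Distr q) := inferInstanceAs (T2Space (ℕ × ℕ → ℂ))

end

/-- The coefficient `a_{jk}` of a formal series. -/
def Distr.coeff {q : Set.Ioo (0 : ℝ) 1} (f : Distr q) (j k : ℕ) : ℂ := f (j, k)

/-- The formal series with given coefficients. -/
def Distr.mk {q : Set.Ioo (0 : ℝ) 1} (a : ℕ → ℕ → ℂ) : Distr q := fun p => a p.1 p.2

/-- The series consisting of the single monomial `z^j z*^k`. -/
def mono (q : Set.Ioo (0 : ℝ) 1) (j k : ℕ) : Distr q :=
  Distr.mk (fun j' k' => if j' = j ∧ k' = k then 1 else 0)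

namespace Distr
variable {q : Set.Ioo (0 : ℝ) 1}

theorem ext' {f g : Distr q} (h : ∀ j k, f.coeff j k = g.coeff j k) : f = g :=
  funext fun p => h p.1 p.2

@[simp] theorem coeff_mk (a : ℕ → ℕ → ℂ) (j k : ℕ) : (Distr.mk a : Distr q).coeff j k = a j k := rfl
@[simp] theorem coeff_add (f g : Distr q) (j k : ℕ) :
    (f + g).coeff j k = f.coeff j k + g.coeff j k := rfl
@[simp] theorem coeff_sub (f g : Distr q) (j k : ℕ) :
    (f - g).coeff j k = f.coeff j k - g.coeff j k := rfl
@[simp] theorem coeff_neg (f : Distr q) (j k : ℕ) : (-f).coeff j k = -f.coeff j k := rfl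
@[simp] theorem coeff_zero (j k : ℕ) : (0 : Distr q).coeff j k = 0 := rfl
@[simp] theorem coeff_smul (c : ℂ) (f : Distr q) (j k : ℕ) :
    (c • f).coeff j k = c * f.coeff j k := rfl

theorem continuous_coeff (j k : ℕ) : Continuous (fun f : Distr q => f.coeff j k) :=
  continuous_apply (A := fun _ : ℕ × ℕ => ℂ) (j, k)

/-- A continuous linear operator given by its coefficients. -/
def op (T : Distr q → ℕ → ℕ → ℂ)
    (hadd : ∀ f g j k, T (f + g) j k = T f j k + T g j k)
    (hsmul : ∀ (c : ℂ) f j k, T (c • f) j k = c * T f j k)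
    (hcont : ∀ j k, Continuous (fun f => T f j k)) : Distr q →L[ℂ] Distr q where
  toFun f := Distr.mk (T f)
  map_add' f g := ext' (by simp [hadd])
  map_smul' c f := ext' (by simp [hsmul])
  cont := continuous_pi (fun p => hcont p.1 p.2)

end Distr

/-- Left multiplication by `z`: `z · z^j z*^k = z^(j+1) z*^k`. -/
def leftZ (q : Set.Ioo (0 : ℝ) 1) : Distr q →L[ℂ] Distr q :=
  Distr.op (fun f j k => match j with | 0 => 0 | j + 1 => f.coeff j k)
    (by intro f g j k; cases j <;> simp)
    (by intro c f j k; cases j <;> simp)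
    (by intro j k; cases j <;> simp [Distr.continuous_coeff, continuous_const])

/-- Left multiplication by `z*`:
`z* · z^j z*^k = q^(2j) z^j z*^(k+1) + (1 - q^(2j)) z^(j-1) z*^k`. -/
def leftZs (q : Set.Ioo (0 : ℝ) 1) : Distr q →L[ℂ] Distr q :=
  Distr.op
    (fun f j k => (match k with | 0 => 0 | k + 1 => qc q ^ (2 * j) * f.coeff j k) +
      (1 - qc q ^ (2 * (j + 1))) * f.coeff (j + 1) k)
    (by intro f g j k; cases k <;> simp <;> ring)
    (by intro c f j k; cases k <;> simp <;> ring)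
    (by
      intro j k
      have := Distr.continuous_coeff (q := q)
      cases k <;> dsimp only <;> fun_prop)

/-- Right multiplication by `z`:
`z^j z*^k · z = q^(2k) z^(j+1) z*^k + (1 - q^(2k)) z^j z*^(k-1)`. -/
def rightZ (q : Set.Ioo (0 : ℝ) 1) : Distr q →L[ℂ] Distr q :=
  Distr.op
    (fun f j k => (match j with | 0 => 0 | j + 1 => qc q ^ (2 * k) * f.coeff j k) +
      (1 - qc q ^ (2 * (k + 1))) * f.coeff j (k + 1))
    (by intro f g j k; cases j <;> simp <;> ring)
    (by intro c f j k; cases j <;> simp <;> ring)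
    (by
      intro j k
      have := Distr.continuous_coeff (q := q)
      cases j <;> dsimp only <;> fun_prop)

section
variable {q : Set.Ioo (0 : ℝ) 1} (f : Distr q) (j k : ℕ)

@[simp] theorem leftZ_zero : (leftZ q f).coeff 0 k = 0 := rfl
@[simp] theorem leftZ_succ : (leftZ q f).coeff (j + 1) k = f.coeff j k := rfl
@[simp] theorem leftZs_zero :
    (leftZs q f).coeff j 0 = (1 - qc q ^ (2 * (j + 1))) * f.coeff (j + 1) 0 := zero_add _
@[simp] theorem leftZs_succ : (leftZs q f).coeff j (k + 1) =
    qc q ^ (2 * j) * f.coeff j k + (1 - qc q ^ (2 * (j + 1))) * f.coeff (j + 1) (k + 1) := rfl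
@[simp] theorem rightZ_zero :
    (rightZ q f).coeff 0 k = (1 - qc q ^ (2 * (k + 1))) * f.coeff 0 (k + 1) := zero_add _
@[simp] theorem rightZ_succ : (rightZ q f).coeff (j + 1) k =
    qc q ^ (2 * k) * f.coeff j k + (1 - qc q ^ (2 * (k + 1))) * f.coeff (j + 1) (k + 1) := rfl

theorem leftZs_leftZ : leftZs q (leftZ q f) =
    qc q ^ 2 • leftZ q (leftZs q f) + (1 - qc q ^ 2) • f := by
  apply Distr.ext'
  rintro (_ | j) (_ | k) <;> simp <;> ring

theorem leftZ_rightZ : leftZ q (rightZ q f) = rightZ q (leftZ q f) := by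
  apply Distr.ext'
  rintro (_ | _ | j) (_ | k) <;> simp

theorem leftZs_rightZ : leftZs q (rightZ q f) = rightZ q (leftZs q f) := by
  apply Distr.ext'
  rintro (_ | _ | j) (_ | _ | k) <;> simp <;> ring

end

/-- The left action of `Pol(ℂ)_q` on `D(U)_q'`. -/
def leftMul (q : Set.Ioo (0 : ℝ) 1) : Pol q →ₐ[ℂ] (Distr q →L[ℂ] Distr q) :=
  polLift q (leftZ q) (leftZs q) (by ext1 f; exact leftZs_leftZ f)

/-- The embedding of `Pol(ℂ)_q` into `D(U)_q'` as the finite sums. -/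
def toDistr (q : Set.Ioo (0 : ℝ) 1) : Pol q →ₗ[ℂ] Distr q where
  toFun f := leftMul q f (mono q 0 0)
  map_add' f g := by simp
  map_smul' c f := by simp

theorem toDistr_one (q : Set.Ioo (0 : ℝ) 1) : toDistr q 1 = mono q 0 0 := by simp [toDistr]

theorem toDistr_z_mul (q : Set.Ioo (0 : ℝ) 1) (f : Pol q) :
    toDistr q (z q * f) = leftZ q (toDistr q f) := by
  simp [toDistr, leftMul, polLift_z]

theorem toDistr_zs_mul (q : Set.Ioo (0 : ℝ) 1) (f : Pol q) :
    toDistr q (zs q * f) = leftZs q (toDistr q f) := by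
  simp [toDistr, leftMul, polLift_zs]

theorem toDistr_mul_z (q : Set.Ioo (0 : ℝ) 1) (f : Pol q) :
    toDistr q (f * z q) = rightZ q (toDistr q f) := by
  induction f using pol_induction with
  | h1 =>
    have h := toDistr_z_mul q 1
    rw [mul_one] at h
    rw [one_mul, h, toDistr_one]
    apply Distr.ext'
    rintro (_ | j) (_ | k) <;> simp [mono]
  | hadd f g hf hg => simp [add_mul, hf, hg]
  | hsmul c f hf => simp [hf]
  | hz f hf => rw [mul_assoc, toDistr_z_mul, hf, toDistr_z_mul, leftZ_rightZ]
  | hzs f hf => rw [mul_assoc, toDistr_zs_mul, hf, toDistr_zs_mul, leftZs_rightZ]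

/-- The monomial `z^j z*^k` has the coefficient `1` at `(j, k)` and `0` elsewhere. -/
theorem toDistr_monomial (q : Set.Ioo (0 : ℝ) 1) (j k : ℕ) :
    toDistr q (z q ^ j * zs q ^ k) = mono q j k := by
  induction j with
  | zero =>
    rw [pow_zero, one_mul]
    induction k with
    | zero => simp [toDistr_one]
    | succ k ih =>
      rw [pow_succ', toDistr_zs_mul, ih]
      apply Distr.ext'
      rintro (_ | j) (_ | k) <;> simp [mono]
  | succ j ih =>
    rw [pow_succ', mul_assoc, toDistr_z_mul, ih]
    apply Distr.ext'
    rintro (_ | j) k <;> simp [mono]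

/-- A continuous operator on `D(U)_q'` is determined by its values on `Pol(ℂ)_q`. -/
theorem distr_hom_ext {q : Set.Ioo (0 : ℝ) 1} {A B : Distr q →L[ℂ] Distr q}
    (h : ∀ f, A (toDistr q f) = B (toDistr q f)) : A = B := by
  ext1 f
  have hs : HasSum (fun p : ℕ × ℕ => f.coeff p.1 p.2 • mono q p.1 p.2) f := by
    refine Pi.hasSum.2 fun p => ?_
    have : f p = f.coeff p.1 p.2 • mono q p.1 p.2 p := by
      simp [mono, Distr.mk, Distr.coeff]
    rw [this]
    refine hasSum_single p fun b hb => ?_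
    have hb' : ¬ (p.1 = b.1 ∧ p.2 = b.2) := fun h => hb (Prod.ext h.1.symm h.2.symm)
    change _ * (if p.1 = b.1 ∧ p.2 = b.2 then (1 : ℂ) else 0) = 0
    rw [if_neg hb', mul_zero]
  have hA := A.hasSum hs
  have hB := B.hasSum hs
  refine hA.unique ?_
  convert hB using 2 with p
  rw [map_smul, map_smul, ← toDistr_monomial, h]

/-- The operator `T'` on `D(U)_q'` is the extension by continuity of the operator `T`
on `Pol(ℂ)_q`. -/
def IsExt {q : Set.Ioo (0 : ℝ) 1} (T : Module.End ℂ (Pol q)) (T' : Distr q →L[ℂ] Distr q) : Prop :=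
  ∀ f, T' (toDistr q f) = toDistr q (T f)

theorem IsExt.unique {q : Set.Ioo (0 : ℝ) 1} {T : Module.End ℂ (Pol q)}
    {A B : Distr q →L[ℂ] Distr q} (hA : IsExt T A) (hB : IsExt T B) : A = B :=
  distr_hom_ext fun f => (hA f).trans (hB f).symm

/-! The extensions of the operators `K^{±1}`, `E`, `F` in coordinates, which come from
`K^{±1} (z^j z*^k) = q^{±2(j-k)} z^j z*^k`,
`E (z^j z*^k) = - q^(1/2) [j] z^(j+1) z*^k + q^(2j) q^(1/2) q^(-2k) [k] z^j z*^(k-1)`,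
`F (z^j z*^k) = q^(2k) q^(1/2) q^(2-2j) [j] z^(j-1) z*^k - q^(5/2) [k] z^j z*^(k+1)`
with `[j] = (1 - q^(2j)) / (1 - q²)`. -/

/-- The number `(1 - q^(2j)) / (1 - q²)`. -/
def qnum (q : Set.Ioo (0 : ℝ) 1) (j : ℕ) : ℂ := (1 - qc q ^ (2 * j)) / (1 - qc q ^ 2)

/-- `K` in coordinates. -/
def dK (q : Set.Ioo (0 : ℝ) 1) : Distr q →L[ℂ] Distr q :=
  Distr.op (fun f j k => qc q ^ (2 * j) / qc q ^ (2 * k) * f.coeff j k)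
    (by intro f g j k; simp; ring) (by intro c f j k; simp; ring)
    (by
      intro j k
      have := Distr.continuous_coeff (q := q)
      fun_prop)

/-- `K⁻¹` in coordinates. -/
def dKinv (q : Set.Ioo (0 : ℝ) 1) : Distr q →L[ℂ] Distr q :=
  Distr.op (fun f j k => qc q ^ (2 * k) / qc q ^ (2 * j) * f.coeff j k)
    (by intro f g j k; simp; ring) (by intro c f j k; simp; ring)
    (by
      intro j k
      have := Distr.continuous_coeff (q := q)
      fun_prop)

/-- `E` in coordinates. -/
def dE (q : Set.Ioo (0 : ℝ) 1) : Distr q →L[ℂ] Distr q :=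
  Distr.op (fun f j k =>
      (match j with | 0 => 0 | j + 1 => -(qh q * qnum q j) * f.coeff j k) +
        qc q ^ (2 * j) * qh q / qc q ^ (2 * (k + 1)) * qnum q (k + 1) * f.coeff j (k + 1))
    (by intro f g j k; cases j <;> simp <;> ring)
    (by intro c f j k; cases j <;> simp <;> ring)
    (by
      intro j k
      have := Distr.continuous_coeff (q := q)
      cases j <;> dsimp only <;> fun_prop)

/-- `F` in coordinates. -/
def dF (q : Set.Ioo (0 : ℝ) 1) : Distr q →L[ℂ] Distr q :=
  Distr.op (fun f j k =>
      (match k with | 0 => 0 | k + 1 => -(qh q * qc q ^ 2 * qnum q k) * f.coeff j k) +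
        qc q ^ (2 * k) * qh q / qc q ^ (2 * j) * qnum q (j + 1) * f.coeff (j + 1) k)
    (by intro f g j k; cases k <;> simp <;> ring)
    (by intro c f j k; cases k <;> simp <;> ring)
    (by
      intro j k
      have := Distr.continuous_coeff (q := q)
      cases k <;> dsimp only <;> fun_prop)

section
variable {q : Set.Ioo (0 : ℝ) 1} (f : Distr q) (j k : ℕ)

@[simp] theorem coeff_dK :
    (dK q f).coeff j k = qc q ^ (2 * j) / qc q ^ (2 * k) * f.coeff j k := rfl
@[simp] theorem coeff_dKinv :
    (dKinv q f).coeff j k = qc q ^ (2 * k) / qc q ^ (2 * j) * f.coeff j k := rfl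
@[simp] theorem dE_zero : (dE q f).coeff 0 k =
    qc q ^ (2 * 0) * qh q / qc q ^ (2 * (k + 1)) * qnum q (k + 1) * f.coeff 0 (k + 1) :=
  zero_add _
@[simp] theorem dE_succ : (dE q f).coeff (j + 1) k = -(qh q * qnum q j) * f.coeff j k +
    qc q ^ (2 * (j + 1)) * qh q / qc q ^ (2 * (k + 1)) * qnum q (k + 1) *
      f.coeff (j + 1) (k + 1) := rfl
@[simp] theorem dF_zero : (dF q f).coeff j 0 =
    qc q ^ (2 * 0) * qh q / qc q ^ (2 * j) * qnum q (j + 1) * f.coeff (j + 1) 0 :=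
  zero_add _
@[simp] theorem dF_succ : (dF q f).coeff j (k + 1) =
    -(qh q * qc q ^ 2 * qnum q k) * f.coeff j k +
    qc q ^ (2 * (k + 1)) * qh q / qc q ^ (2 * j) * qnum q (j + 1) *
      f.coeff (j + 1) (k + 1) := rfl

theorem dK_leftZ : dK q (leftZ q f) = qc q ^ 2 • leftZ q (dK q f) := by
  apply Distr.ext'
  rintro (_ | j) k <;> simp <;> ring

theorem dK_leftZs : dK q (leftZs q f) = (qc q ^ 2)⁻¹ • leftZs q (dK q f) := by
  have := qc_ne q
  apply Distr.ext'
  rintro j (_ | k) <;> simp <;> field_simp <;> ring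

theorem dKinv_leftZ : dKinv q (leftZ q f) = (qc q ^ 2)⁻¹ • leftZ q (dKinv q f) := by
  have := qc_ne q
  apply Distr.ext'
  rintro (_ | j) k <;> simp <;> field_simp <;> ring

theorem dKinv_leftZs : dKinv q (leftZs q f) = qc q ^ 2 • leftZs q (dKinv q f) := by
  have := qc_ne q
  apply Distr.ext'
  rintro j (_ | k) <;> simp <;> field_simp <;> ring

theorem dE_leftZ : dE q (leftZ q f) =
    -(qh q • leftZ q (leftZ q f)) + qc q ^ 2 • leftZ q (dE q f) := by
  have := qc_ne q
  have := one_sub_ne q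
  apply Distr.ext'
  rintro (_ | _ | j) k <;> simp [qnum] <;> field_simp <;> ring

theorem dE_leftZs : dE q (leftZs q f) =
    (qh q / qc q ^ 2) • f + (qc q ^ 2)⁻¹ • leftZs q (dE q f) := by
  have := qc_ne q
  have := one_sub_ne q
  apply Distr.ext'
  rintro (_ | j) (_ | k) <;> simp [qnum] <;> field_simp <;> ring

theorem dF_leftZ : dF q (leftZ q f) = qh q • dKinv q f + leftZ q (dF q f) := by
  have := qc_ne q
  have := one_sub_ne q
  apply Distr.ext'
  rintro (_ | j) (_ | k) <;> simp [qnum] <;> field_simp <;> first | ring1 | simp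

theorem dF_leftZs : dF q (leftZs q f) =
    -((qh q * qc q ^ 2) • leftZs q (leftZs q (dKinv q f))) + leftZs q (dF q f) := by
  have := qc_ne q
  have := one_sub_ne q
  apply Distr.ext'
  rintro j (_ | _ | k) <;> simp [qnum] <;> field_simp <;> ring

end

theorem isExt_K (q : Set.Ioo (0 : ℝ) 1) : IsExt (polGen q .K) (dK q) := by
  intro f
  change dK q _ = toDistr q (polK q f)
  induction f using pol_induction with
  | h1 =>
    rw [map_one (polK q), toDistr_one]
    apply Distr.ext'
    rintro (_ | j) (_ | k) <;> simp [mono]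
  | hadd f g hf hg => simp [hf, hg]
  | hsmul c f hf => simp [hf]
  | hz f hf => simp [toDistr_z_mul, dK_leftZ, hf]
  | hzs f hf => simp [toDistr_zs_mul, dK_leftZs, hf]

theorem isExt_Kinv (q : Set.Ioo (0 : ℝ) 1) : IsExt (polGen q .Kinv) (dKinv q) := by
  intro f
  change dKinv q _ = toDistr q (polKinv q f)
  induction f using pol_induction with
  | h1 =>
    rw [map_one (polKinv q), toDistr_one]
    apply Distr.ext'
    rintro (_ | j) (_ | k) <;> simp [mono]
  | hadd f g hf hg => simp [hf, hg]
  | hsmul c f hf => simp [hf]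
  | hz f hf => simp [toDistr_z_mul, dKinv_leftZ, hf]
  | hzs f hf => simp [toDistr_zs_mul, dKinv_leftZs, hf]

theorem isExt_E (q : Set.Ioo (0 : ℝ) 1) : IsExt (polGen q .E) (dE q) := by
  intro f
  change dE q _ = toDistr q (polE q f)
  induction f using pol_induction with
  | h1 =>
    rw [polE_one, map_zero, toDistr_one]
    apply Distr.ext'
    rintro (_ | _ | j) (_ | k) <;> simp [mono, qnum]
  | hadd f g hf hg => simp [hf, hg]
  | hsmul c f hf => simp [hf]
  | hz f hf => simp [toDistr_z_mul, polE_mul, dE_leftZ, hf, mul_assoc]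
  | hzs f hf => simp [toDistr_zs_mul, polE_mul, dE_leftZs, hf]

theorem isExt_F (q : Set.Ioo (0 : ℝ) 1) : IsExt (polGen q .F) (dF q) := by
  intro f
  change dF q _ = toDistr q (polF q f)
  have hK : ∀ g, toDistr q (polKinv q g) = dKinv q (toDistr q g) :=
    fun g => (isExt_Kinv q g).symm
  induction f using pol_induction with
  | h1 =>
    rw [polF_one, map_zero, toDistr_one]
    apply Distr.ext'
    rintro (_ | j) (_ | _ | k) <;> simp [mono, qnum]
  | hadd f g hf hg => simp [hf, hg]
  | hsmul c f hf => simp [hf]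
  | hz f hf => simp [toDistr_z_mul, polF_mul, dF_leftZ, hf, hK]
  | hzs f hf => simp [toDistr_zs_mul, polF_mul, dF_leftZs, hf, hK, mul_assoc]

/-- Every element of `U_q sl₂` acts on `Pol(ℂ)_q` by an operator that extends by continuity
to `D(U)_q'`. -/
theorem exists_isExt (q : Set.Ioo (0 : ℝ) 1) (a : Uq q) : ∃ T', IsExt (polAct q a) T' := by
  induction a using u_induction with
  | hc c => exact ⟨c • 1, fun f => by simp [Algebra.algebraMap_eq_smul_one]⟩
  | hadd a b ha hb =>
    obtain ⟨A, hA⟩ := ha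
    obtain ⟨B, hB⟩ := hb
    exact ⟨A + B, fun f => by simp [hA f, hB f]⟩
  | hmul a b ha hb =>
    obtain ⟨A, hA⟩ := ha
    obtain ⟨B, hB⟩ := hb
    exact ⟨A * B, fun f => by simp [hA _, hB f]⟩
  | hg g =>
    rw [polAct_ugen]
    cases g
    · exact ⟨_, isExt_K q⟩
    · exact ⟨_, isExt_Kinv q⟩
    · exact ⟨_, isExt_E q⟩
    · exact ⟨_, isExt_F q⟩

/-- The extension by continuity to `D(U)_q'` of the action of `a ∈ U_q sl₂` on `Pol(ℂ)_q`. -/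
def actFun (q : Set.Ioo (0 : ℝ) 1) (a : Uq q) : Distr q →L[ℂ] Distr q :=
  (exists_isExt q a).choose

theorem isExt_actFun (q : Set.Ioo (0 : ℝ) 1) (a : Uq q) : IsExt (polAct q a) (actFun q a) :=
  (exists_isExt q a).choose_spec

/-- The action of `U_q sl₂` on `D(U)_q'`. -/
def act (q : Set.Ioo (0 : ℝ) 1) : Uq q →ₐ[ℂ] (Distr q →L[ℂ] Distr q) where
  toFun := actFun q
  map_one' := (isExt_actFun q 1).unique fun f => by simp
  map_mul' a b := (isExt_actFun q (a * b)).unique fun f => by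
    simp [isExt_actFun q a _, isExt_actFun q b f]
  map_zero' := (isExt_actFun q 0).unique fun f => by simp
  map_add' a b := (isExt_actFun q (a + b)).unique fun f => by
    simp [isExt_actFun q a _, isExt_actFun q b f]
  commutes' c := (isExt_actFun q _).unique fun f => by
    simp [Algebra.algebraMap_eq_smul_one]

instance (q : Set.Ioo (0 : ℝ) 1) : Module (Uq q) (Distr q) :=
  Module.compHom (Distr q) (act q).toRingHom

theorem smul_def (q : Set.Ioo (0 : ℝ) 1) (a : Uq q) (f : Distr q) : a • f = act q a f := rfl

theorem algebraMap_smul' (q : Set.Ioo (0 : ℝ) 1) (c : ℂ) (f : Distr q) :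
    algebraMap ℂ (Uq q) c • f = c • f := by
  rw [smul_def, AlgHom.commutes, Algebra.algebraMap_eq_smul_one]
  simp

theorem smul_toDistr (q : Set.Ioo (0 : ℝ) 1) (a : Uq q) (f : Pol q) :
    a • toDistr q f = toDistr q (polAct q a f) := isExt_actFun q a f

theorem act_K (q : Set.Ioo (0 : ℝ) 1) : act q (ugen q .K) = dK q :=
  (isExt_actFun q _).unique (by rw [polAct_ugen]; exact isExt_K q)

theorem act_Kinv (q : Set.Ioo (0 : ℝ) 1) : act q (ugen q .Kinv) = dKinv q :=
  (isExt_actFun q _).unique (by rw [polAct_ugen]; exact isExt_Kinv q)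

theorem act_E (q : Set.Ioo (0 : ℝ) 1) : act q (ugen q .E) = dE q :=
  (isExt_actFun q _).unique (by rw [polAct_ugen]; exact isExt_E q)

theorem act_F (q : Set.Ioo (0 : ℝ) 1) : act q (ugen q .F) = dF q :=
  (isExt_actFun q _).unique (by rw [polAct_ugen]; exact isExt_F q)

/-! ### Finite functions -/

theorem dK_rightZ {q : Set.Ioo (0 : ℝ) 1} (f : Distr q) :
    dK q (rightZ q f) = qc q ^ 2 • rightZ q (dK q f) := by
  have := qc_ne q
  apply Distr.ext'
  rintro (_ | j) k <;> simp <;> field_simp <;> ring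

theorem dKinv_rightZ {q : Set.Ioo (0 : ℝ) 1} (f : Distr q) :
    dKinv q (rightZ q f) = (qc q ^ 2)⁻¹ • rightZ q (dKinv q f) := by
  have := qc_ne q
  apply Distr.ext'
  rintro (_ | j) k <;> simp <;> field_simp <;> ring

theorem dE_rightZ {q : Set.Ioo (0 : ℝ) 1} (f : Distr q) :
    dE q (rightZ q f) = rightZ q (dE q f) - qh q • rightZ q (rightZ q (dK q f)) := by
  have h : dE q * rightZ q = rightZ q * dE q - qh q • (rightZ q * rightZ q * dK q) := by
    refine distr_hom_ext fun g => ?_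
    have h1 := isExt_E q (g * z q)
    have h2 := isExt_E q g
    have h3 := isExt_K q g
    simp only [polGen, AlgHom.toLinearMap_apply] at h1 h2 h3
    rw [toDistr_mul_z, polE_mul, polE_z] at h1
    simp [h1, h2, h3, toDistr_mul_z, ← mul_assoc, sub_eq_add_neg]
  exact congrArg (fun A : Distr q →L[ℂ] Distr q => A f) h

theorem dF_rightZ {q : Set.Ioo (0 : ℝ) 1} (f : Distr q) :
    dF q (rightZ q f) = (qc q ^ 2)⁻¹ • rightZ q (dF q f) + qh q • f := by
  have h : dF q * rightZ q = (qc q ^ 2)⁻¹ • (rightZ q * dF q) + qh q • 1 := by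
    refine distr_hom_ext fun g => ?_
    have h1 := isExt_F q (g * z q)
    have h2 := isExt_F q g
    simp only [polGen] at h1 h2
    rw [toDistr_mul_z, polF_mul, polF_z] at h1
    simp [h1, h2, toDistr_mul_z]
  exact congrArg (fun A : Distr q →L[ℂ] Distr q => A f) h

/-- The condition `z*^N f = f z^N = 0` for some `N`. -/
def IsFinite {q : Set.Ioo (0 : ℝ) 1} (f : Distr q) : Prop :=
  ∃ N : ℕ, (leftZs q ^ N) f = 0 ∧ (rightZ q ^ N) f = 0

theorem pow_apply_eq_zero_of_le {q : Set.Ioo (0 : ℝ) 1} (A : Distr q →L[ℂ] Distr q) {M N : ℕ}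
    (h : M ≤ N) {f : Distr q} (hf : (A ^ M) f = 0) : (A ^ N) f = 0 := by
  obtain ⟨c, rfl⟩ := Nat.exists_eq_add_of_le' h
  rw [pow_add, mul_apply_eq_comp, hf, map_zero]

/-- If `A T f` is a combination of `T A f` and of elements that are killed by powers of `A` as
soon as `f` is, then `T` preserves the elements that are killed by a power of `A`. -/
theorem pow_apply_stable {q : Set.Ioo (0 : ℝ) 1} (A T S : Distr q →L[ℂ] Distr q) (c : ℂ)
    (hS : ∀ N f, (A ^ N) f = 0 → (A ^ N) (S f) = 0)
    (h : ∀ f, A (T f) = c • T (A f) + S f) (N : ℕ) :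
    ∀ f, (A ^ N) f = 0 → (A ^ (N + 1)) (T f) = 0 := by
  induction N with
  | zero =>
    intro f hf
    have : f = 0 := by simpa using hf
    simp [this]
  | succ N ih =>
    intro f hf
    have h1 : (A ^ N) (A f) = 0 := by
      rw [pow_succ] at hf
      exact hf
    have h2 := ih _ h1
    rw [pow_succ, mul_apply_eq_comp, h, map_add, map_smul, h2, hS _ _ hf]
    simp

theorem pow_apply_comm {q : Set.Ioo (0 : ℝ) 1} (A T : Distr q →L[ℂ] Distr q) (c : ℂ)
    (h : ∀ f, A (T f) = c • T (A f)) (N : ℕ) :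
    ∀ f, (A ^ N) f = 0 → (A ^ N) (T f) = 0 := by
  induction N with
  | zero =>
    intro f hf
    have : f = 0 := by simpa using hf
    simp [this]
  | succ N ih =>
    intro f hf
    rw [pow_succ, mul_apply_eq_comp] at hf ⊢
    rw [h, map_smul, ih _ hf, smul_zero]

theorem leftZs_dK {q : Set.Ioo (0 : ℝ) 1} (f : Distr q) :
    leftZs q (dK q f) = qc q ^ 2 • dK q (leftZs q f) := by
  rw [dK_leftZs, smul_smul, mul_inv_cancel₀ (pow_ne_zero 2 (qc_ne q)), one_smul]

theorem leftZs_dKinv {q : Set.Ioo (0 : ℝ) 1} (f : Distr q) :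
    leftZs q (dKinv q f) = (qc q ^ 2)⁻¹ • dKinv q (leftZs q f) := by
  rw [dKinv_leftZs, smul_smul, inv_mul_cancel₀ (pow_ne_zero 2 (qc_ne q)), one_smul]

theorem rightZ_dK {q : Set.Ioo (0 : ℝ) 1} (f : Distr q) :
    rightZ q (dK q f) = (qc q ^ 2)⁻¹ • dK q (rightZ q f) := by
  rw [dK_rightZ, smul_smul, inv_mul_cancel₀ (pow_ne_zero 2 (qc_ne q)), one_smul]

theorem rightZ_dKinv {q : Set.Ioo (0 : ℝ) 1} (f : Distr q) :
    rightZ q (dKinv q f) = qc q ^ 2 • dKinv q (rightZ q f) := by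
  rw [dKinv_rightZ, smul_smul, mul_inv_cancel₀ (pow_ne_zero 2 (qc_ne q)), one_smul]

theorem isFinite_gen {q : Set.Ioo (0 : ℝ) 1} (g : UGen) {f : Distr q} (hf : IsFinite f) :
    IsFinite (ugen q g • f) := by
  have h0 := qc_ne q
  obtain ⟨N, hl, hr⟩ := hf
  rw [smul_def]
  have key : ∀ (A B : Distr q →L[ℂ] Distr q) (c d : ℂ) (N : ℕ) (f : Distr q),
      (∀ f, A (B f) = c • B (A f)) → (A ^ N) f = 0 → (A ^ N) ((d • (A ^ 2 * B)) f) = 0 := by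
    intro A B c d N f hAB hf
    have h1 := pow_apply_comm A B c hAB N f hf
    have h2 : (A ^ N) ((A ^ 2) (B f)) = 0 := by
      rw [← mul_apply_eq_comp, ← pow_add, add_comm, pow_add,
        mul_apply_eq_comp, h1, map_zero]
    simp only [smul_apply, mul_apply_eq_comp, map_smul, h2,
      smul_zero]
  cases g
  · rw [act_K]
    exact ⟨N, pow_apply_comm _ _ _ leftZs_dK _ _ hl, pow_apply_comm _ _ _ rightZ_dK _ _ hr⟩
  · rw [act_Kinv]
    exact ⟨N, pow_apply_comm _ _ _ leftZs_dKinv _ _ hl, pow_apply_comm _ _ _ rightZ_dKinv _ _ hr⟩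
  · rw [act_E]
    refine ⟨N + 1, pow_apply_stable (leftZs q) (dE q) (-(qh q) • 1) (qc q ^ 2) ?_ ?_ N f hl,
      pow_apply_stable (rightZ q) (dE q) (qh q • (rightZ q ^ 2 * dK q)) 1 ?_ ?_ N f hr⟩
    · intro N f hf
      rw [smul_apply, one_apply_eq_self, map_smul, hf, smul_zero]
    · intro f
      rw [dE_leftZs]
      simp only [smul_apply, one_apply_eq_self]
      match_scalars <;> field_simp <;> ring
    · exact fun N f hf => key _ _ _ _ N f rightZ_dK hf
    · intro f
      rw [dE_rightZ]
      simp [pow_two]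
  · rw [act_F]
    refine ⟨N + 1, pow_apply_stable (leftZs q) (dF q)
        ((qh q * qc q ^ 2) • (leftZs q ^ 2 * dKinv q)) 1 ?_ ?_ N f hl,
      pow_apply_stable (rightZ q) (dF q) (-(qh q * qc q ^ 2) • 1) (qc q ^ 2) ?_ ?_ N f hr⟩
    · exact fun N f hf => key _ _ _ _ N f leftZs_dKinv hf
    · intro f
      rw [dF_leftZs]
      simp [pow_two]
    · intro N f hf
      rw [smul_apply, one_apply_eq_self, map_smul, hf, smul_zero]
    · intro f
      rw [dF_rightZ]
      simp only [smul_apply, one_apply_eq_self]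
      match_scalars <;> field_simp <;> ring

/-- The `U_q sl₂`-module `D(U)_q` of finite functions in the quantum disc, as a submodule of the
`U_q sl₂`-module `D(U)_q'`: it consists of the `f` with `z*^N f = f z^N = 0` for some `N`. -/
def finiteFunctions (q : Set.Ioo (0 : ℝ) 1) : Submodule (Uq q) (Distr q) where
  carrier := {f | IsFinite f}
  zero_mem' := ⟨0, by simp, by simp⟩
  add_mem' := by
    rintro f g ⟨M, hM1, hM2⟩ ⟨N, hN1, hN2⟩
    refine ⟨max M N, ?_, ?_⟩
    · rw [map_add, pow_apply_eq_zero_of_le _ (le_max_left M N) hM1,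
        pow_apply_eq_zero_of_le _ (le_max_right M N) hN1, add_zero]
    · rw [map_add, pow_apply_eq_zero_of_le _ (le_max_left M N) hM2,
        pow_apply_eq_zero_of_le _ (le_max_right M N) hN2, add_zero]
  smul_mem' := by
    intro a
    induction a using u_induction with
    | hc c =>
      rintro f ⟨N, h1, h2⟩
      exact ⟨N, by rw [algebraMap_smul', map_smul, h1, smul_zero],
        by rw [algebraMap_smul', map_smul, h2, smul_zero]⟩
    | hadd a b ha hb =>
      intro f hf
      obtain ⟨M, hM1, hM2⟩ := ha hf
      obtain ⟨N, hN1, hN2⟩ := hb hf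
      refine ⟨max M N, ?_, ?_⟩
      · rw [add_smul, map_add, pow_apply_eq_zero_of_le _ (le_max_left M N) hM1,
          pow_apply_eq_zero_of_le _ (le_max_right M N) hN1, add_zero]
      · rw [add_smul, map_add, pow_apply_eq_zero_of_le _ (le_max_left M N) hM2,
          pow_apply_eq_zero_of_le _ (le_max_right M N) hN2, add_zero]
    | hmul a b ha hb =>
      intro f hf
      rw [mul_smul]
      exact ha (hb hf)
    | hg g => exact fun {f} hf => isFinite_gen g hf

/-! ### Matrix elements -/

/-- The operator `T(z) e_m = (1 - q^(2(m+1)))^(1/2) e_(m+1)`. -/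
def fockZ (q : Set.Ioo (0 : ℝ) 1) : Module.End ℂ (ℕ →₀ ℂ) :=
  Finsupp.linearCombination ℂ fun m =>
    Finsupp.single (m + 1) ((Real.sqrt (1 - (q : ℝ) ^ (2 * (m + 1))) : ℝ) : ℂ)

/-- The operator `T(z*) e_m = (1 - q^(2m))^(1/2) e_(m-1)`, with `T(z*) e_0 = 0`. -/
def fockZs (q : Set.Ioo (0 : ℝ) 1) : Module.End ℂ (ℕ →₀ ℂ) :=
  Finsupp.linearCombination ℂ fun m =>
    Finsupp.single (m - 1) ((Real.sqrt (1 - (q : ℝ) ^ (2 * m)) : ℝ) : ℂ)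

theorem fock_sqrt_sq (q : Set.Ioo (0 : ℝ) 1) (m : ℕ) :
    ((Real.sqrt (1 - (q : ℝ) ^ (2 * m)) : ℝ) : ℂ) * ((Real.sqrt (1 - (q : ℝ) ^ (2 * m)) : ℝ) : ℂ)
      = 1 - qc q ^ (2 * m) := by
  rw [← Complex.ofReal_mul, Real.mul_self_sqrt]
  · simp [qc]
  · have := pow_le_one₀ (n := 2 * m) q.2.1.le q.2.2.le
    linarith

/-- The representation `T` of `Pol(ℂ)_q` by operators in the space with the basis `e_m`,
`m = 0, 1, 2, …`, for which `T(z)` and `T(z*)` are adjoint to each other. -/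
def fock (q : Set.Ioo (0 : ℝ) 1) : Pol q →ₐ[ℂ] Module.End ℂ (ℕ →₀ ℂ) :=
  polLift q (fockZ q) (fockZs q) (by
    refine Finsupp.lhom_ext' fun m => LinearMap.ext_ring ?_
    rcases m with _ | m
    · have h1 := fock_sqrt_sq q 1
      ext i
      simp [fockZ, fockZs, Finsupp.single_apply] at h1 ⊢
      split_ifs
      · linear_combination h1
      · ring
    · have h1 := fock_sqrt_sq q (m + 1)
      have h2 := fock_sqrt_sq q (m + 1 + 1)
      ext i
      simp [fockZ, fockZs, Finsupp.single_apply]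
      split_ifs
      · linear_combination h2 - qc q ^ 2 * h1
      · ring)

@[simp] theorem fock_z (q : Set.Ioo (0 : ℝ) 1) : fock q (z q) = fockZ q := polLift_z ..
@[simp] theorem fock_zs (q : Set.Ioo (0 : ℝ) 1) : fock q (zs q) = fockZs q := polLift_zs ..

/-- `T(z^j)` has its range in the span of the `e_m` with `m ≥ j`. -/
theorem fockZ_pow_apply (q : Set.Ioo (0 : ℝ) 1) (j : ℕ) (v : ℕ →₀ ℂ) :
    ∀ m < j, (fockZ q ^ j) v m = 0 := by
  induction j with
  | zero => simp
  | succ j ih =>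
    have key : ∀ w : ℕ →₀ ℂ, fockZ q w 0 = 0 ∧ ∀ m, w m = 0 → fockZ q w (m + 1) = 0 := by
      intro w
      refine ⟨?_, fun m hm => ?_⟩
      · rw [fockZ, Finsupp.linearCombination_apply, Finsupp.sum_apply]
        exact Finset.sum_eq_zero fun i _ => by simp
      · rw [fockZ, Finsupp.linearCombination_apply, Finsupp.sum_apply]
        refine Finset.sum_eq_zero fun i _ => ?_
        rcases eq_or_ne i m with rfl | h
        · simp [hm]
        · simp [Finsupp.single_apply, h]
    intro m hm
    rw [pow_succ', Module.End.mul_apply]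
    rcases m with _ | m
    · exact (key _).1
    · exact (key _).2 m (ih m (by omega))

/-- `T(z*^k) e_n = 0` for `k > n`. -/
theorem fockZs_pow_single (q : Set.Ioo (0 : ℝ) 1) (k : ℕ) :
    ∀ n < k, ∀ c : ℂ, (fockZs q ^ k) (Finsupp.single n c) = 0 := by
  induction k with
  | zero => simp
  | succ k ih =>
    intro n hn c
    rw [pow_succ, Module.End.mul_apply]
    rcases n with _ | n
    · simp [fockZs]
    · rw [fockZs, Finsupp.linearCombination_single, Finsupp.smul_single]
      exact ih n (by omega) _

/-- The monomials `z^j z*^k` with `j > m` or `k > n` do not contribute to the matrix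
element with the indices `m`, `n`. -/
theorem fock_monomial_eq_zero (q : Set.Ioo (0 : ℝ) 1) (j k m n : ℕ) (h : m < j ∨ n < k) :
    fock q (z q ^ j * zs q ^ k) (Finsupp.single n 1) m = 0 := by
  rw [map_mul, map_pow, map_pow, fock_z, fock_zs, Module.End.mul_apply]
  rcases h with h | h
  · exact fockZ_pow_apply q j _ m h
  · rw [fockZs_pow_single q k n h, map_zero, Finsupp.zero_apply]

/-- The matrix element `l_{mn}(f)`, i.e. the coefficient of `e_m` in `T(f) e_n`, for a formal
series `f = ∑ a_{jk} z^j z*^k`.  It is the sum of `a_{jk} l_{mn}(z^j z*^k)` over all `j`, `k`,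
where only the terms with `j ≤ m` and `k ≤ n` can be different from `0`. -/
def matrixElem (q : Set.Ioo (0 : ℝ) 1) (m n : ℕ) (f : Distr q) : ℂ :=
  ∑ j ∈ Finset.range (m + 1), ∑ k ∈ Finset.range (n + 1),
    f.coeff j k * fock q (z q ^ j * zs q ^ k) (Finsupp.single n 1) m

end

end QDisc

namespace QDisc

variable {q : Set.Ioo (0 : ℝ) 1}

/-! ### Formal series are determined by their matrix elements -/

/-! Everything rests on two commuting operators on formal series, `f ↦ z* f` and `f ↦ f z`. On
matrix elements they shift the row, respectively the column, with nonzero factors: `l_{mn}(z* f)` is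
a multiple of `l_{m+1,n}(f)`, and `l_{mn}(f z)` of `l_{m,n+1}(f)`. Moreover `l_{00}(f)` is the
constant term. A series whose matrix elements all vanish therefore keeps this property, and a zero
constant term, under both operators, and this forces all its coefficients to vanish
(`eq_zero_of_stable`, `matrixElem_ext`). This gives uniqueness.

For existence, solve `z* f₀ = f₀ z = 0` with constant term `1`: the series `f₀ = ∑ c_j z^j z*^j`
satisfies both equations by one and the same recursion for `c_j`. The shift rules then kill every
`l_{mn}(f₀)` except `l_{00}`.

For generation, the series `z^m f₀ z*^n` play the role of matrix units. They span the finite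
functions: `f₀` spans the common kernel of the two operators, and each operator lowers the
corresponding exponent by one with a nonzero factor, so a ladder argument applies first to `f z` and
then to `z* f` (`mem_of_pow_apply_eq_zero`, `mem_span_matrixUnit`). Finally, `E` takes `z^m f₀` to a
nonzero multiple of `z^(m+1) f₀`, and `F` takes `z^m f₀ z*^n` to a nonzero multiple of `z^m f₀
z*^(n+1)` plus a term with smaller `m`, so all of them lie in the module generated by `f₀`
(`matrixUnit_mem_span`). -/

theorem one_sub_pow_ne (q : Set.Ioo (0 : ℝ) 1) (n : ℕ) : 1 - qc q ^ (2 * (n + 1)) ≠ 0 := by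
  have h : (1 : ℝ) - (q : ℝ) ^ (2 * (n + 1)) ≠ 0 :=
    (sub_pos.2 (pow_lt_one₀ q.2.1.le q.2.2 (by omega))).ne'
  simp only [qc]
  exact_mod_cast h

theorem fock_sqrt_ne (q : Set.Ioo (0 : ℝ) 1) (n : ℕ) :
    ((Real.sqrt (1 - (q : ℝ) ^ (2 * (n + 1))) : ℝ) : ℂ) ≠ 0 := by
  intro h
  have := fock_sqrt_sq q (n + 1)
  rw [h, zero_mul] at this
  exact one_sub_pow_ne q n this.symm

/-- The normal ordering rule: it moves `z*` to the right past a power of `z`, so that left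
multiplication by `z*` preserves the span of the ordered monomials. -/
theorem zs_mul_z_pow (q : Set.Ioo (0 : ℝ) 1) (j : ℕ) :
    zs q * z q ^ (j + 1) =
      qc q ^ (2 * (j + 1)) • (z q ^ (j + 1) * zs q) + (1 - qc q ^ (2 * (j + 1))) • z q ^ j := by
  induction j with
  | zero => simpa using zs_mul_z q
  | succ j ih =>
    rw [pow_succ (z q) (j + 1), ← mul_assoc, ih, add_mul, smul_mul_assoc, mul_assoc, zs_mul_z,
      smul_mul_assoc, ← pow_succ]
    simp only [mul_add, smul_add, mul_smul_comm, mul_one, ← mul_assoc, ← pow_succ]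
    module

/-- The monomials `z^j z*^k` span `Pol(ℂ)_q`. -/
theorem mem_span_monomials (p : Pol q) :
    p ∈ Submodule.span ℂ (Set.range fun i : ℕ × ℕ => z q ^ i.1 * zs q ^ i.2) := by
  set V := Submodule.span ℂ (Set.range fun i : ℕ × ℕ => z q ^ i.1 * zs q ^ i.2) with hV
  have hm : ∀ j k, z q ^ j * zs q ^ k ∈ V := fun j k => Submodule.subset_span ⟨(j, k), rfl⟩
  have hmul : ∀ a : Pol q, (∀ j k, a * (z q ^ j * zs q ^ k) ∈ V) → ∀ f ∈ V, a * f ∈ V := by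
    intro a ha f hf
    have : V ≤ V.comap (LinearMap.mulLeft ℂ a) := by
      conv_lhs => rw [hV]
      rw [Submodule.span_le]
      rintro _ ⟨i, rfl⟩
      exact ha i.1 i.2
    exact this hf
  induction p using pol_induction with
  | h1 => simpa using hm 0 0
  | hadd f g hf hg => exact V.add_mem hf hg
  | hsmul c f hf => exact V.smul_mem c hf
  | hz f hf =>
    refine hmul _ (fun j k => ?_) f hf
    rw [← mul_assoc, ← pow_succ']
    exact hm _ _
  | hzs f hf =>
    refine hmul _ (fun j k => ?_) f hf
    rcases j with _ | j
    · simpa [← pow_succ'] using hm 0 (k + 1)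
    · rw [← mul_assoc, zs_mul_z_pow, add_mul, smul_mul_assoc, smul_mul_assoc, mul_assoc,
        ← pow_succ']
      exact V.add_mem (V.smul_mem _ (hm _ _)) (V.smul_mem _ (hm _ _))

/-- The array of the matrix elements of a formal series. -/
noncomputable def matrixOp (q : Set.Ioo (0 : ℝ) 1) : Distr q →L[ℂ] Distr q :=
  Distr.op (fun f m n => matrixElem q m n f)
    (by intro f g m n; simp [matrixElem, add_mul, Finset.sum_add_distrib])
    (by intro c f m n; simp [matrixElem, Finset.mul_sum, mul_assoc])
    (by
      intro m n
      have := Distr.continuous_coeff (q := q)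
      unfold matrixElem
      fun_prop)

@[simp] theorem coeff_matrixOp (f : Distr q) (m n : ℕ) :
    (matrixOp q f).coeff m n = matrixElem q m n f := rfl

theorem matrixElem_mono (j k m n : ℕ) :
    matrixElem q m n (mono q j k) = fock q (z q ^ j * zs q ^ k) (Finsupp.single n 1) m := by
  by_cases h : m < j ∨ n < k
  · rw [fock_monomial_eq_zero q j k m n h]
    refine Finset.sum_eq_zero fun j' hj => Finset.sum_eq_zero fun k' hk => ?_
    rw [Finset.mem_range] at hj hk
    rw [mono, Distr.coeff_mk, if_neg (by omega), zero_mul]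
  · push Not at h
    rw [matrixElem, Finset.sum_eq_single_of_mem j (Finset.mem_range.2 (by omega)),
      Finset.sum_eq_single_of_mem k (Finset.mem_range.2 (by omega))]
    · simp [mono]
    · intro k' _ hk
      simp [mono, hk]
    · intro j' _ hj
      simp [mono, hj]

/-- The link between formal series and the representation: on polynomials the truncated sum is a
genuine matrix element, so multiplicativity of `fock` becomes available. -/
theorem matrixElem_toDistr (m n : ℕ) (p : Pol q) :
    matrixElem q m n (toDistr q p) = fock q p (Finsupp.single n 1) m := by
  induction mem_span_monomials p using Submodule.span_induction with
  | mem p hp =>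
    obtain ⟨i, rfl⟩ := hp
    rw [← matrixElem_mono, toDistr_monomial]
  | zero => simp [matrixElem]
  | add f g _ _ hf hg =>
    -- Linearity of the matrix elements is taken from the linear map `matrixOp`; `coeff_matrixOp` is
    -- switched off so that `simp` does not undo this rewriting.
    rw [← coeff_matrixOp] at hf hg ⊢
    simp [-coeff_matrixOp, hf, hg]
  | smul c f _ hf =>
    rw [← coeff_matrixOp] at hf ⊢
    simp [-coeff_matrixOp, hf]

/-! ### Matrix elements of `z* f` and `f z` -/

theorem fockZs_apply (v : ℕ →₀ ℂ) (m : ℕ) :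
    fockZs q v m = ((Real.sqrt (1 - (q : ℝ) ^ (2 * (m + 1))) : ℝ) : ℂ) * v (m + 1) := by
  induction v using Finsupp.induction_linear with
  | zero => simp
  | add f g hf hg => simp [hf, hg, mul_add]
  | single n c =>
    rcases n with _ | n
    -- Here `0 - 1` truncates to `0`, but the factor `√(1 - q^0)` is zero, so `e_0` is indeed
    -- killed.
    · simp [fockZs]
    · rw [fockZs, Finsupp.linearCombination_single]
      rcases eq_or_ne n m with rfl | h
      · simp [mul_comm]
      · simp [h]

/-- For polynomials this is `T(z* p) = T(z*) T(p)` read off in row `m`. Both sides are continuous in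
`f`, so it extends to all series. -/
theorem matrixElem_leftZs (f : Distr q) (m n : ℕ) :
    matrixElem q m n (leftZs q f) =
      ((Real.sqrt (1 - (q : ℝ) ^ (2 * (m + 1))) : ℝ) : ℂ) * matrixElem q (m + 1) n f := by
  -- The weighted row shift of an array; the claim becomes an equality of continuous operators,
  -- which `distr_hom_ext` reduces to polynomials.
  let S : Distr q →L[ℂ] Distr q :=
    Distr.op (fun f m n => ((Real.sqrt (1 - (q : ℝ) ^ (2 * (m + 1))) : ℝ) : ℂ) * f.coeff (m + 1) n)
      (by intro f g m n; simp; ring) (by intro c f m n; simp; ring)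
      (by
        intro m n
        have := Distr.continuous_coeff (q := q)
        fun_prop)
  have h : matrixOp q * leftZs q = S * matrixOp q := by
    refine distr_hom_ext fun p => Distr.ext' fun m n => ?_
    change matrixElem q m n (leftZs q (toDistr q p)) = _ * matrixElem q (m + 1) n (toDistr q p)
    rw [← toDistr_zs_mul, matrixElem_toDistr, matrixElem_toDistr, map_mul, fock_zs,
      Module.End.mul_apply, fockZs_apply]
  exact congrArg (fun A : Distr q →L[ℂ] Distr q => (A f).coeff m n) h

theorem matrixElem_rightZ (f : Distr q) (m n : ℕ) :
    matrixElem q m n (rightZ q f) =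
      ((Real.sqrt (1 - (q : ℝ) ^ (2 * (n + 1))) : ℝ) : ℂ) * matrixElem q m (n + 1) f := by
  let S : Distr q →L[ℂ] Distr q :=
    Distr.op (fun f m n => ((Real.sqrt (1 - (q : ℝ) ^ (2 * (n + 1))) : ℝ) : ℂ) * f.coeff m (n + 1))
      (by intro f g m n; simp; ring) (by intro c f m n; simp; ring)
      (by
        intro m n
        have := Distr.continuous_coeff (q := q)
        fun_prop)
  have h : matrixOp q * rightZ q = S * matrixOp q := by
    refine distr_hom_ext fun p => Distr.ext' fun m n => ?_
    change matrixElem q m n (rightZ q (toDistr q p)) = _ * matrixElem q m (n + 1) (toDistr q p)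
    rw [← toDistr_mul_z, matrixElem_toDistr, matrixElem_toDistr, map_mul, fock_z,
      Module.End.mul_apply, fockZ, Finsupp.linearCombination_single, one_smul,
      ← Finsupp.smul_single_one, map_smul, Finsupp.smul_apply, smul_eq_mul]
  exact congrArg (fun A : Distr q →L[ℂ] Distr q => (A f).coeff m n) h

theorem matrixElem_zero_zero (f : Distr q) : matrixElem q 0 0 f = f.coeff 0 0 := by
  simp [matrixElem]

/-- A set of formal series without constant terms that is stable under the left multiplication
by `z*` and the right multiplication by `z` contains at most the zero series. -/
theorem eq_zero_of_stable (S : Set (Distr q)) (h0 : ∀ f ∈ S, f.coeff 0 0 = 0)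
    (hl : ∀ f ∈ S, leftZs q f ∈ S) (hr : ∀ f ∈ S, rightZ q f ∈ S) : ∀ f ∈ S, f = 0 := by
  -- The series is quantified last because the induction replaces `f` by `f z` along the row `j = 0`
  -- and by `z* f` when `j` grows; the new coefficient appears there with the nonzero factor `1 -
  -- q^(2k+2)` or `1 - q^(2j+2)`.
  have key : ∀ j k, ∀ f ∈ S, f.coeff j k = 0 := by
    intro j
    induction j with
    | zero =>
      intro k
      induction k with
      | zero => exact h0
      | succ k ih =>
        intro f hf
        have h := ih _ (hr f hf)
        rw [rightZ_zero] at h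
        exact (mul_eq_zero.1 h).resolve_left (one_sub_pow_ne q k)
    | succ j ih =>
      intro k f hf
      have h := ih k _ (hl f hf)
      rcases k with _ | k
      · rw [leftZs_zero] at h
        exact (mul_eq_zero.1 h).resolve_left (one_sub_pow_ne q j)
      · rw [leftZs_succ, ih k f hf, mul_zero, zero_add] at h
        exact (mul_eq_zero.1 h).resolve_left (one_sub_pow_ne q j)
  exact fun f hf => Distr.ext' fun j k => key j k f hf

/-- A formal series is determined by its matrix elements. -/
theorem matrixElem_ext {f g : Distr q} (h : ∀ m n, matrixElem q m n f = matrixElem q m n g) :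
    f = g := by
  refine sub_eq_zero.1 (eq_zero_of_stable {f | ∀ m n, matrixElem q m n f = 0} ?_ ?_ ?_ _ ?_)
  · exact fun f hf => (matrixElem_zero_zero f).symm.trans (hf 0 0)
  · exact fun f hf m n => by rw [matrixElem_leftZs, hf, mul_zero]
  · exact fun f hf m n => by rw [matrixElem_rightZ, hf, mul_zero]
  · intro m n
    rw [← coeff_matrixOp, map_sub, Distr.coeff_sub, coeff_matrixOp, coeff_matrixOp, h, sub_self]

/-! ### The series `f₀ z*^n` and `z^m f₀ z*^n` -/

/-- The coefficients of the series `f₀ = ∑ c_j z^j z*^j`. -/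
noncomputable def vacuumCoeff (q : Set.Ioo (0 : ℝ) 1) : ℕ → ℂ
  | 0 => 1
  | j + 1 => -(qc q ^ (2 * j) / (1 - qc q ^ (2 * (j + 1)))) * vacuumCoeff q j

/-- The series `f₀ z*^n`, where `f₀ = ∑ c_j z^j z*^j`. -/
noncomputable def vacuumRow (q : Set.Ioo (0 : ℝ) 1) (n : ℕ) : Distr q :=
  Distr.mk fun j k => if k = j + n then vacuumCoeff q j else 0

@[simp] theorem coeff_vacuumRow (n j k : ℕ) :
    (vacuumRow q n).coeff j k = if k = j + n then vacuumCoeff q j else 0 := rfl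

/-- The recursion of `vacuumCoeff` is this equation: the coefficient at `(j, j + n + 1)` is `q^(2j)
c_j + (1 - q^(2j+2)) c_{j+1}`. -/
theorem leftZs_vacuumRow (n : ℕ) : leftZs q (vacuumRow q n) = 0 := by
  apply Distr.ext'
  rintro j (_ | k)
  · rw [leftZs_zero, coeff_vacuumRow, if_neg (by omega), mul_zero, Distr.coeff_zero]
  · rw [leftZs_succ, coeff_vacuumRow, coeff_vacuumRow, Distr.coeff_zero]
    have := one_sub_pow_ne q j
    rcases eq_or_ne k (j + n) with rfl | h
    · rw [if_pos rfl, if_pos (by omega), vacuumCoeff]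
      field_simp
      ring
    · rw [if_neg (by omega), if_neg (by omega)]
      ring

theorem rightZ_vacuumRow_zero : rightZ q (vacuumRow q 0) = 0 := by
  apply Distr.ext'
  rintro (_ | j) k
  · simp
  · rw [rightZ_succ, coeff_vacuumRow, coeff_vacuumRow, Distr.coeff_zero]
    have := one_sub_pow_ne q j
    rcases eq_or_ne k j with rfl | h
    · rw [if_pos (by omega), if_pos (by omega), vacuumCoeff]
      field_simp
      ring
    · rw [if_neg (by omega), if_neg (by omega)]
      ring

/-- Moving `z` to the left through `z*^(n+1)` produces a term with `f₀ z = 0` and `(1 - q^(2n+2)) f₀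
z*^n`. The proof compares coefficients. -/
theorem rightZ_vacuumRow_succ (n : ℕ) :
    rightZ q (vacuumRow q (n + 1)) = (1 - qc q ^ (2 * (n + 1))) • vacuumRow q n := by
  apply Distr.ext'
  rintro (_ | j) k
  · rw [rightZ_zero, coeff_vacuumRow, Distr.coeff_smul, coeff_vacuumRow]
    rcases eq_or_ne k n with rfl | h
    · simp
    · simp [h]
  · rw [rightZ_succ, coeff_vacuumRow, coeff_vacuumRow, Distr.coeff_smul, coeff_vacuumRow]
    have := one_sub_pow_ne q j
    rcases eq_or_ne k (j + (n + 1)) with rfl | h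
    · rw [if_pos rfl, if_pos (by omega), if_pos (by omega), vacuumCoeff]
      field_simp
      ring
    · rw [if_neg h, if_neg (by omega), if_neg (by omega)]
      ring

/-- The factor does not depend on `n`: by covariance, `F f₀ · K⁻¹ z*^n` contributes `q^(2n) / (1 -
q²)` and `f₀ · F z*^n` contributes `(1 - q^(2n)) / (1 - q²)`, both times `-q^(5/2)`. In coordinates
only the recursion for `c_j` is needed. -/
theorem dF_vacuumRow (n : ℕ) :
    dF q (vacuumRow q n) = (-(qh q * qc q ^ 2) / (1 - qc q ^ 2)) • vacuumRow q (n + 1) := by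
  apply Distr.ext'
  have := one_sub_ne q
  rintro j (_ | k)
  · rw [dF_zero, Distr.coeff_smul, coeff_vacuumRow, coeff_vacuumRow, if_neg (by omega),
      if_neg (by omega), mul_zero, mul_zero]
  · rw [dF_succ, coeff_vacuumRow, coeff_vacuumRow, Distr.coeff_smul, coeff_vacuumRow]
    have := one_sub_pow_ne q j
    have := qc_ne q
    rcases eq_or_ne k (j + n) with rfl | h
    · rw [if_pos rfl, if_pos (by omega), if_pos (by omega), vacuumCoeff, qnum, qnum]
      field_simp
      ring
    · rw [if_neg h, if_neg (by omega), if_neg (by omega)]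
      ring

theorem dE_vacuumRow_zero :
    dE q (vacuumRow q 0) = (-qh q / (1 - qc q ^ 2)) • leftZ q (vacuumRow q 0) := by
  apply Distr.ext'
  have := one_sub_ne q
  rintro (_ | j) k
  · simp
  · rw [dE_succ, coeff_vacuumRow, coeff_vacuumRow, Distr.coeff_smul, leftZ_succ, coeff_vacuumRow]
    have := one_sub_pow_ne q j
    have := qc_ne q
    rcases eq_or_ne k j with rfl | h
    · rw [if_pos (by omega), if_pos (by omega), vacuumCoeff, qnum, qnum]
      field_simp
      ring
    · rw [if_neg (by omega), if_neg (by omega)]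
      ring

theorem dKinv_vacuumRow (n : ℕ) : dKinv q (vacuumRow q n) = qc q ^ (2 * n) • vacuumRow q n := by
  have := qc_ne q
  apply Distr.ext'
  intro j k
  rw [coeff_dKinv, Distr.coeff_smul, coeff_vacuumRow]
  split_ifs with h
  · subst h
    field_simp
    ring
  · simp

/-- The series `z^m f₀ z*^n`. -/
noncomputable def matrixUnit (q : Set.Ioo (0 : ℝ) 1) : ℕ → ℕ → Distr q
  | 0, n => vacuumRow q n
  | m + 1, n => leftZ q (matrixUnit q m n)

theorem matrixUnit_succ (m n : ℕ) : matrixUnit q (m + 1) n = leftZ q (matrixUnit q m n) := rfl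

theorem leftZs_matrixUnit_succ (m n : ℕ) :
    leftZs q (matrixUnit q (m + 1) n) = (1 - qc q ^ (2 * (m + 1))) • matrixUnit q m n := by
  induction m with
  | zero => simp [matrixUnit, leftZs_leftZ, leftZs_vacuumRow]
  | succ m ih =>
    rw [matrixUnit, leftZs_leftZ, ih, map_smul, ← matrixUnit]
    module

/-- As for `F`, the contributions of `E z^m` and of `E f₀` add up to a factor independent of `m`.
The restriction to the column `n = 0` avoids the extra term in `z^m f₀ z*^(n-1)` coming from `E
z*^n`. -/
theorem dE_matrixUnit_zero (m : ℕ) :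
    dE q (matrixUnit q m 0) = (-qh q / (1 - qc q ^ 2)) • matrixUnit q (m + 1) 0 := by
  have := one_sub_ne q
  induction m with
  | zero => exact dE_vacuumRow_zero
  | succ m ih =>
    rw [matrixUnit, dE_leftZ, ih, map_smul, ← matrixUnit, ← matrixUnit]
    match_scalars
    field_simp
    ring

theorem dKinv_matrixUnit (m n : ℕ) :
    ∃ c : ℂ, dKinv q (matrixUnit q m n) = c • matrixUnit q m n := by
  induction m with
  | zero => exact ⟨_, dKinv_vacuumRow n⟩
  | succ m ih =>
    obtain ⟨c, hc⟩ := ih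
    exact ⟨(qc q ^ 2)⁻¹ * c, by rw [matrixUnit, dKinv_leftZ, hc, map_smul, smul_smul]⟩

/-- The second term arises because `F` turns one factor `z` into a scalar, while `K⁻¹` acts on what
follows it by a scalar. The value of `c` is immaterial, since that term is later subtracted as
already known. -/
theorem dF_matrixUnit_succ (m n : ℕ) : ∃ c : ℂ, dF q (matrixUnit q (m + 1) n) =
    (-(qh q * qc q ^ 2) / (1 - qc q ^ 2)) • matrixUnit q (m + 1) (n + 1) +
      c • matrixUnit q m n := by
  induction m with
  | zero =>
    refine ⟨qh q * qc q ^ (2 * n), ?_⟩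
    rw [matrixUnit_succ, matrixUnit_succ, matrixUnit, matrixUnit, dF_leftZ, dKinv_vacuumRow,
      dF_vacuumRow, map_smul]
    module
  | succ m ih =>
    obtain ⟨d, hd⟩ := dKinv_matrixUnit (q := q) (m + 1) n
    obtain ⟨c, hc⟩ := ih
    refine ⟨qh q * d + c, ?_⟩
    rw [matrixUnit_succ, dF_leftZ, hd, hc, map_add, map_smul, map_smul, ← matrixUnit_succ,
      ← matrixUnit_succ]
    module

/-! ### Finite functions are spanned by the `z^m f₀ z*^n` -/

theorem leftZs_rightZ_pow (f : Distr q) (N : ℕ) :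
    leftZs q ((rightZ q ^ N) f) = (rightZ q ^ N) (leftZs q f) := by
  induction N generalizing f with
  | zero => rfl
  | succ N ih => rw [pow_succ, mul_apply_eq_comp, mul_apply_eq_comp, ih, leftZs_rightZ]

/-- Let `W ≤ V` with `V` stable under `A`. If `W` contains the kernel of `A` in `V` and `A` maps
`W` onto a space containing `W`, then `W` contains all elements of `V` killed by a power of `A`. -/
theorem mem_of_pow_apply_eq_zero {A : Distr q →L[ℂ] Distr q} {V W : Submodule ℂ (Distr q)}
    (hWV : W ≤ V) (hA : ∀ f ∈ V, A f ∈ V) (hker : ∀ f ∈ V, A f = 0 → f ∈ W)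
    (hsurj : W ≤ W.map (A : Distr q →ₗ[ℂ] Distr q)) (N : ℕ) :
    ∀ f ∈ V, (A ^ N) f = 0 → f ∈ W := by
  induction N with
  | zero =>
    intro f _ hf
    have : f = 0 := by simpa using hf
    exact this ▸ W.zero_mem
  | succ N ih =>
    intro f hfV hf
    -- By induction `A f` lies in `W`, hence equals `A u` with `u` in `W`; then `f - u` is in the
    -- kernel.
    obtain ⟨u, hu, hAu⟩ := hsurj (ih (A f) (hA f hfV) (by rwa [pow_succ] at hf))
    have h : f - u ∈ W := hker _ (V.sub_mem hfV (hWV hu)) (by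
      rw [map_sub, sub_eq_zero]
      exact hAu.symm)
    simpa using W.add_mem h hu

theorem eq_smul_vacuumRow {f : Distr q} (hl : leftZs q f = 0) (hr : rightZ q f = 0) :
    f = f.coeff 0 0 • vacuumRow q 0 := by
  -- This set is stable because both operators send its elements to `0`; subtracting the multiple of
  -- `f₀` removes the constant term.
  refine sub_eq_zero.1 (eq_zero_of_stable
    {f | f.coeff 0 0 = 0 ∧ leftZs q f = 0 ∧ rightZ q f = 0} (fun f hf => hf.1) ?_ ?_ _ ?_)
  · rintro f ⟨-, h, -⟩
    simp [h]
  · rintro f ⟨-, -, h⟩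
    simp [h]
  · simp [hl, hr, leftZs_vacuumRow, rightZ_vacuumRow_zero, vacuumCoeff]

/-- The ladder argument for `f ↦ f z` inside the kernel of `f ↦ z* f`: the common kernel is spanned
by `f₀`, and `f₀ z*^(n+1)` is a preimage of `f₀ z*^n` up to a nonzero factor. -/
theorem mem_span_vacuumRow {f : Distr q} (hl : leftZs q f = 0) {N : ℕ}
    (hr : (rightZ q ^ N) f = 0) : f ∈ Submodule.span ℂ (Set.range (vacuumRow q)) := by
  refine mem_of_pow_apply_eq_zero (A := rightZ q)
    (V := LinearMap.ker (leftZs q : Distr q →ₗ[ℂ] Distr q)) ?_ ?_ ?_ ?_ N f hl hr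
  · rw [Submodule.span_le]
    rintro _ ⟨n, rfl⟩
    exact leftZs_vacuumRow n
  · intro f hf
    have hf : leftZs q f = 0 := hf
    change leftZs q (rightZ q f) = 0
    rw [leftZs_rightZ, hf, map_zero]
  · intro f hf h
    rw [eq_smul_vacuumRow hf h]
    exact Submodule.smul_mem _ _ (Submodule.subset_span ⟨0, rfl⟩)
  · rw [Submodule.span_le]
    rintro _ ⟨n, rfl⟩
    refine ⟨(1 - qc q ^ (2 * (n + 1)))⁻¹ • vacuumRow q (n + 1),
      Submodule.smul_mem _ _ (Submodule.subset_span ⟨n + 1, rfl⟩), ?_⟩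
    rw [map_smul]
    change _ • rightZ q (vacuumRow q (n + 1)) = _
    rw [rightZ_vacuumRow_succ, smul_smul, inv_mul_cancel₀ (one_sub_pow_ne q n), one_smul]

theorem rightZ_leftZ_pow (f : Distr q) (N : ℕ) :
    (rightZ q ^ N) (leftZ q f) = leftZ q ((rightZ q ^ N) f) := by
  induction N generalizing f with
  | zero => rfl
  | succ N ih => rw [pow_succ, mul_apply_eq_comp, mul_apply_eq_comp, ← leftZ_rightZ, ih]

theorem rightZ_pow_matrixUnit (m n : ℕ) : (rightZ q ^ (n + 1)) (matrixUnit q m n) = 0 := by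
  induction m with
  | zero =>
    rw [matrixUnit]
    induction n with
    | zero => simpa using rightZ_vacuumRow_zero
    | succ n ih => rw [pow_succ, mul_apply_eq_comp, rightZ_vacuumRow_succ, map_smul, ih, smul_zero]
  | succ m ih => rw [matrixUnit, rightZ_leftZ_pow, ih, map_zero]

/-- The formal series `f` with `f z^N = 0` for some `N`. -/
def rightTorsion (q : Set.Ioo (0 : ℝ) 1) : Submodule ℂ (Distr q) where
  carrier := {f | ∃ N, (rightZ q ^ N) f = 0}
  zero_mem' := ⟨0, map_zero _⟩
  add_mem' := by
    rintro f g ⟨M, hM⟩ ⟨N, hN⟩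
    refine ⟨max M N, ?_⟩
    rw [map_add, pow_apply_eq_zero_of_le _ (le_max_left M N) hM,
      pow_apply_eq_zero_of_le _ (le_max_right M N) hN, add_zero]
  smul_mem' := by
    rintro c f ⟨N, hN⟩
    exact ⟨N, by rw [map_smul, hN, smul_zero]⟩

/-- The second ladder, for `f ↦ z* f` on the series killed by some right power of `z`; its kernel
there is covered by `mem_span_vacuumRow`. -/
theorem mem_span_matrixUnit {f : Distr q} (hf : IsFinite f) :
    f ∈ Submodule.span ℂ (Set.range fun i : ℕ × ℕ => matrixUnit q i.1 i.2) := by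
  obtain ⟨N, hl, hr⟩ := hf
  refine mem_of_pow_apply_eq_zero (A := leftZs q) (V := rightTorsion q) ?_ ?_ ?_ ?_ N f ⟨N, hr⟩ hl
  · rw [Submodule.span_le]
    rintro _ ⟨i, rfl⟩
    exact ⟨_, rightZ_pow_matrixUnit i.1 i.2⟩
  · rintro f ⟨M, hM⟩
    exact ⟨M, by rw [← leftZs_rightZ_pow, hM, map_zero]⟩
  · rintro f ⟨M, hM⟩ h
    refine Submodule.span_mono ?_ (mem_span_vacuumRow h hM)
    rintro _ ⟨n, rfl⟩
    exact ⟨(0, n), rfl⟩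
  · rw [Submodule.span_le]
    rintro _ ⟨⟨m, n⟩, rfl⟩
    refine ⟨(1 - qc q ^ (2 * (m + 1)))⁻¹ • matrixUnit q (m + 1) n,
      Submodule.smul_mem _ _ (Submodule.subset_span ⟨(m + 1, n), rfl⟩), ?_⟩
    rw [map_smul]
    change _ • leftZs q (matrixUnit q (m + 1) n) = _
    rw [leftZs_matrixUnit_succ, smul_smul, inv_mul_cancel₀ (one_sub_pow_ne q m), one_smul]

/-! ### The series `f₀` generates the module of finite functions -/

/-- Complex scalars act through `U_q sl₂`, so its submodules are complex subspaces. -/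
theorem smul_mem_of_mem {S : Submodule (Uq q) (Distr q)} (c : ℂ) {f : Distr q} (hf : f ∈ S) :
    c • f ∈ S := by
  rw [← algebraMap_smul']
  exact S.smul_mem _ hf

theorem mem_of_smul_mem {S : Submodule (Uq q) (Distr q)} {c : ℂ} (hc : c ≠ 0) {f : Distr q}
    (hf : c • f ∈ S) : f ∈ S := by
  simpa [smul_smul, hc] using smul_mem_of_mem c⁻¹ hf

theorem qh_ne (q : Set.Ioo (0 : ℝ) 1) : qh q ≠ 0 := by
  intro h
  have := qh_sq q
  rw [h] at this
  exact qc_ne q (by simpa using this.symm)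

theorem matrixUnit_mem_span (m n : ℕ) :
    matrixUnit q m n ∈ Submodule.span (Uq q) {vacuumRow q 0} := by
  have hh := qh_ne q
  have hq := qc_ne q
  have h1 := one_sub_ne q
  set S := Submodule.span (Uq q) {vacuumRow q 0}
  have hE : ∀ f ∈ S, dE q f ∈ S := by
    intro f hf
    rw [← act_E, ← smul_def]
    exact S.smul_mem _ hf
  have hF : ∀ f ∈ S, dF q f ∈ S := by
    intro f hf
    rw [← act_F, ← smul_def]
    exact S.smul_mem _ hf
  have hc : -(qh q * qc q ^ 2) / (1 - qc q ^ 2) ≠ 0 :=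
    div_ne_zero (neg_ne_zero.2 (mul_ne_zero hh (pow_ne_zero 2 hq))) h1
  -- The column `n = 0` is climbed with `E`. Passing to column `n + 1` with `F` needs both `z^(m+1)
  -- f₀ z*^n` and `z^m f₀ z*^n`, hence the hypothesis for all `m`.
  induction n generalizing m with
  | zero =>
    induction m with
    | zero => exact Submodule.mem_span_singleton_self _
    | succ m ih =>
      refine mem_of_smul_mem (div_ne_zero (neg_ne_zero.2 hh) h1) ?_
      rw [← dE_matrixUnit_zero]
      exact hE _ ih
  | succ n ih =>
    refine mem_of_smul_mem hc ?_
    rcases m with _ | m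
    · rw [matrixUnit, ← dF_vacuumRow]
      exact hF _ (ih 0)
    · obtain ⟨c, h⟩ := dF_matrixUnit_succ (q := q) m n
      rw [← sub_eq_iff_eq_add] at h
      rw [← h]
      exact S.sub_mem (hF _ (ih (m + 1))) (smul_mem_of_mem c (ih m))

theorem isFinite_vacuumRow_zero : IsFinite (vacuumRow q 0) :=
  ⟨1, by simpa using leftZs_vacuumRow 0, by simpa using rightZ_vacuumRow_zero⟩

theorem span_vacuumRow_zero : Submodule.span (Uq q) {vacuumRow q 0} = finiteFunctions q := by
  apply le_antisymm
  · rw [Submodule.span_singleton_le_iff_mem]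
    exact isFinite_vacuumRow_zero
  · intro f hf
    have h := mem_span_matrixUnit hf
    clear hf
    induction h using Submodule.span_induction with
    | mem f hf =>
      obtain ⟨i, rfl⟩ := hf
      exact matrixUnit_mem_span i.1 i.2
    | zero => exact Submodule.zero_mem _
    | add f g _ _ hf hg => exact Submodule.add_mem _ hf hg
    | smul c f _ hf => exact smul_mem_of_mem c hf

/-- A matrix element with a positive index is, up to a nonzero square root, one of `z* f₀ = 0` or
`f₀ z = 0`. -/
theorem matrixElem_vacuumRow_zero (m n : ℕ) :
    matrixElem q m n (vacuumRow q 0) = if m = 0 ∧ n = 0 then 1 else 0 := by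
  have h0 : ∀ m n, matrixElem q m n (0 : Distr q) = 0 := fun m n => by simp [matrixElem]
  rcases m with _ | m
  · rcases n with _ | n
    · simp [matrixElem_zero_zero, vacuumCoeff]
    · have h := matrixElem_rightZ (vacuumRow q 0) 0 n
      rw [rightZ_vacuumRow_zero, h0, zero_eq_mul] at h
      rw [h.resolve_left (fock_sqrt_ne q n), if_neg (by omega)]
  · have h := matrixElem_leftZs (vacuumRow q 0) m n
    rw [leftZs_vacuumRow, h0, zero_eq_mul] at h
    rw [h.resolve_left (fock_sqrt_ne q m), if_neg (by omega)]

end QDisc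

theorem theorem3p9 (q : Set.Ioo (0 : ℝ) 1) :
    ∃ f₀ : QDisc.Distr q,
      (∀ f : QDisc.Distr q,
        (f ∈ QDisc.finiteFunctions q ∧
          ∀ m n : ℕ, QDisc.matrixElem q m n f = if m = 0 ∧ n = 0 then 1 else 0) ↔ f = f₀) ∧
      Submodule.span (QDisc.Uq q) {f₀} = QDisc.finiteFunctions q := by
  refine ⟨QDisc.vacuumRow q 0, fun f => ⟨fun h => QDisc.matrixElem_ext fun m n => ?_, ?_⟩,
    QDisc.span_vacuumRow_zero⟩
  · rw [h.2, QDisc.matrixElem_vacuumRow_zero]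
  · rintro rfl
    exact ⟨QDisc.isFinite_vacuumRow_zero, QDisc.matrixElem_vacuumRow_zero⟩
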